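/- Let $N\ge 2$, $d\ge 0$ be integers, $m>0$, and let $\eta^\circ:\mathbb R^d\to\mathbb C$ be a Lévy exponent. The Markovian symmetric synchronization model $\mathcal{GMS}_N(\eta^\circ;m)$ is the process $x(t)=(x_1(t),\dots,x_N(t))\in(\mathbb R^d)^N$, $t\ge 0$, defined as follows. (Free dynamics) $x^\circ_1,\dots,x^\circ_N$ are independent Lévy processes in $\mathbb R^d$ (started at $0$, with independent stationary increments, stochastically continuous, taken in a version with right-continuous trajectories) with $\mathsf E\,e^{i\langle\lambda,x^\circ_j(t)\rangle}=e^{t\eta^\circ(\lambda)}$ for all $t\ge0$, $\lambda\in\mathbb R^d$. (Messages) Each component $k$ sends messages at times $0<\tau^{(k)}_1<\tau^{(k)}_2<\cdots$, where $\tau^{(k)}_0=0$ and the increments $\tau^{(k)}_n-\tau^{(k)}_{n-1}$, $n\ge1$, $1\le k\le N$, are i.i.d. exponential with mean $m$. The recipient of each message of $k$ is chosen independently and uniformly among the $N-1$ other components. (Initial state) The law of $x(0)$ is invariant under permutations of the components. The initial state $x(0)$, the free dynamics, the message times and the choices of recipients are independent. (Interaction) Let $0=T_0<T_1<T_2<\cdots$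 be the increasing enumeration of all message times $\tau^{(k)}_n$, $n\ge1$, $1\le k\le N$. On $[0,T_1]$ one has $x(t)-x(0)=x^\circ(t)-x^\circ(0)$. If the message at time $T_q$ is sent by $k$ to $j$, then $x_j(T_q+0)=x_k(T_q)$ and $x_i(T_q+0)=x_i(T_q)$ for $i\ne j$. For $t\in(T_q,T_{q+1}]$ one has $x(t)=x(T_q+0)+x^\circ(t)-x^\circ(T_q)$. Put $$\boldsymbol\eta(\lambda)=-2\,\mathrm{Re}\,\eta^\circ(\lambda),\qquad w_N=\frac{2}{(N-1)m},\qquad q_N(\lambda)=\boldsymbol\eta(\lambda)+w_N .$$ **Theorem.** For the model $\mathcal{GMS}_N(\eta^\circ;m)$: 1. The characteristic function $\chi_N(t;\lambda)=\mathsf E\exp\bigl(i\langle\lambda,x_j(t)-x_k(t)\rangle\bigr)$ is the same for all pairs $j\ne k$. 2. For every $\lambda\in\mathbb R^d$ and every $t\ge0$ (with the right derivative at $t=0$), $$\frac{d}{dt}\chi_N(t;\lambda)=-q_N(\lambda)\,\chi_N(t;\lambda)+w_N .$$ 3. As $t\to\infty$, the law of $x_j(t)-x_k(t)$, $j\neq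 k$, converges weakly to a probability measure $P_{N,\infty}$ on $\mathbb R^d$ that does not depend on the pair $(j,k)$, $\chi_N(t;\lambda)$ converges for every $\lambda\in\mathbb R^d$, and the limit $\chi_N(\infty;\lambda)$, which is the characteristic function of $P_{N,\infty}$, is $$\chi_N(\infty;\lambda)=\int_{\mathbb R^d}e^{i\langle\lambda,x\rangle}\,P_{N,\infty}(dx)=\frac{1}{1+\frac12(N-1)\,m\,\boldsymbol\eta(\lambda)} .$$ -/

import Mathlib

open MeasureTheory ProbabilityTheory Filter Topology
open scoped NNReal

namespace SyncModel

/-! ### Lévy processes -/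

/-- `X` is a Lévy process in `ℝ^d`: it starts at the origin, has independent and stationary
increments and is stochastically continuous.  As usual the version with right-continuous
trajectories is taken; this is what gives a meaning to the values of `X` at random epochs. -/
structure IsLevyProcess {Ω : Type*} [MeasurableSpace Ω] (P : Measure Ω) {d : ℕ}
    (X : ℝ≥0 → Ω → EuclideanSpace ℝ (Fin d)) : Prop where
  measurable : ∀ t, Measurable (X t)
  start_zero : ∀ᵐ ω ∂P, X 0 ω = 0
  indep_increments : HasIndepIncrements X P
  stationary_increments : ∀ s t, IdentDistrib (fun ω => X (s + t) ω - X s ω) (X t) P P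
  stochastically_continuous : ∀ t, TendstoInMeasure P X (𝓝 t) (X t)
  right_continuous : ∀ᵐ ω ∂P, ∀ t, ContinuousWithinAt (fun s => X s ω) (Set.Ici t) t

/-- `X` is a Lévy process with Lévy exponent `ψ`, that is
`E exp (i ⟨u, X t⟩) = exp (t ψ(u))` for all `t ≥ 0` and all `u`. -/
structure IsLevyWithExponent {Ω : Type*} [MeasurableSpace Ω] (P : Measure Ω) {d : ℕ}
    (X : ℝ≥0 → Ω → EuclideanSpace ℝ (Fin d)) (ψ : EuclideanSpace ℝ (Fin d) → ℂ) : Prop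
    extends IsLevyProcess P X where
  charFun_eq : ∀ (t : ℝ≥0) (u : EuclideanSpace ℝ (Fin d)),
    charFun (P.map (X t)) u = Complex.exp ((t : ℂ) * ψ u)

/-! ### Trajectories of the synchronization system -/

/-- The random ingredients of an `N`-component synchronization system in `ℝ^d`.
Messages of a component are numbered from `0`: `gap k n` is the time between the `n`-th and the
`(n+1)`-st message of `k` (the time up to the first one if `n = 0`), and `dest k n` is the
recipient of the message of `k` that is sent at the end of that interval. -/
structure Ingredients (Ω : Type*) (N d : ℕ) where
  /-- the initial configuration `x(0)` -/
  init : Ω → Fin N → EuclideanSpace ℝ (Fin d)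
  /-- the free dynamics -/
  free : Fin N → ℝ≥0 → Ω → EuclideanSpace ℝ (Fin d)
  /-- the inter-event times -/
  gap : Fin N → ℕ → Ω → ℝ
  /-- the recipients of the messages -/
  dest : Fin N → ℕ → Ω → Fin N

/-- The map `S_{i,j}` of the set of components: it sends `j` to `i` and fixes everything else. -/
def pairMap {N : ℕ} (i j : Fin N) : Fin N → Fin N := Function.update id j i

namespace Ingredients

variable {Ω : Type*} {N d : ℕ}

/-- The time at which component `k` sends its message number `n` (numbered from `0`). -/
noncomputable def sendTime (S : Ingredients Ω N d) (k : Fin N) (n : ℕ) (ω : Ω) : ℝ :=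
  ∑ i ∈ Finset.range (n + 1), S.gap k i ω

/-- The synchronization epochs `0 = T_0 < T_1 < T_2 < ⋯`: the superposition of the `N` flows of
sending times, enumerated in increasing order. -/
noncomputable def epoch (S : Ingredients Ω N d) (ω : Ω) : ℕ → ℝ
  | 0 => 0
  | q + 1 => sInf {s : ℝ | epoch S ω q < s ∧ ∃ k n, S.sendTime k n ω = s}

open Classical in
/-- The synchronization map applied at time `s`: if the message number `n` of `k` is sent at
time `s` to the component `j`, this is `S_{k,j}`.  (Almost surely no two messages are
simultaneous.) -/
noncomputable def jumpMap (S : Ingredients Ω N d) (ω : Ω) (s : ℝ) : Fin N → Fin N :=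
  if h : ∃ p : Fin N × ℕ, S.sendTime p.1 p.2 ω = s then
    pairMap h.choose.1 (S.dest h.choose.1 h.choose.2 ω)
  else id

/-- The configuration `x(T_q + 0)` just after the `q`-th synchronization jump; for `q = 0` this
is `x(0)`.  Between two epochs the system follows the increments of the free dynamics, and at
`T_{q+1}` the configuration `x = x(T_{q+1})` is replaced by `x ∘ M_{q+1}`. -/
noncomputable def afterJump (S : Ingredients Ω N d) (ω : Ω) :
    ℕ → Fin N → EuclideanSpace ℝ (Fin d)
  | 0 => S.init ω
  | q + 1 =>
      (fun j => afterJump S ω q j +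
          (S.free j (S.epoch ω (q + 1)).toNNReal ω - S.free j (S.epoch ω q).toNNReal ω)) ∘
        S.jumpMap ω (S.epoch ω (q + 1))

/-- The number of synchronization jumps that act on `x(t)`: the `q` with
`T_q < t ≤ T_{q+1}` (and `0` for `0 ≤ t ≤ T_1`). -/
noncomputable def jumpsBefore (S : Ingredients Ω N d) (ω : Ω) (t : ℝ≥0) : ℕ :=
  sInf {q : ℕ | (t : ℝ) ≤ S.epoch ω (q + 1)}

/-- The state `x_j(t)` of component `j` at time `t`:
`x(t) = x(T_q + 0) + (x°(t) - x°(T_q))` for `T_q < t ≤ T_{q+1}`. -/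
noncomputable def state (S : Ingredients Ω N d) (j : Fin N) (t : ℝ≥0) (ω : Ω) :
    EuclideanSpace ℝ (Fin d) :=
  S.afterJump ω (S.jumpsBefore ω t) j +
    (S.free j t ω - S.free j (S.epoch ω (S.jumpsBefore ω t)).toNNReal ω)

/-- The difference `d_{jk}(t) = x_j(t) - x_k(t)`. -/
noncomputable def diff (S : Ingredients Ω N d) (j k : Fin N) (t : ℝ≥0) (ω : Ω) :
    EuclideanSpace ℝ (Fin d) :=
  S.state j t ω - S.state k t ω

/-- The characteristic function `χ_{N,j,k}(t; u) = E exp (i ⟨u, x_j(t) - x_k(t)⟩)`. -/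
noncomputable def chi [MeasurableSpace Ω] (S : Ingredients Ω N d) (P : Measure Ω)
    (j k : Fin N) (t : ℝ≥0) (u : EuclideanSpace ℝ (Fin d)) : ℂ :=
  ∫ ω, Complex.exp (Complex.I * (inner ℝ u (S.diff j k t ω) : ℝ)) ∂P

end Ingredients

/-! ### The probabilistic models -/

/-- The general model `GG_N({ψ_j}; {F_j}, R)`: free dynamics `x°_j` that are independent Lévy
processes with exponents `ψ_j`, independent renewal flows of messages with inter-event laws
`F_j`, recipients chosen independently according to the routing matrix `R`; the initial
configuration, the free dynamics, the flows and the routing are independent. -/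
structure IsGG {Ω : Type*} [MeasurableSpace Ω] (P : Measure Ω) {N d : ℕ}
    (S : Ingredients Ω N d) (ψ : Fin N → EuclideanSpace ℝ (Fin d) → ℂ)
    (F : Fin N → Measure ℝ) (R : Matrix (Fin N) (Fin N) ℝ) : Prop where
  measurable_init : Measurable S.init
  levy_free : ∀ j, IsLevyWithExponent P (S.free j) (ψ j)
  indep_free : iIndepFun (fun (j : Fin N) (ω : Ω) (t : ℝ≥0) => S.free j t ω) P
  measurable_gap : ∀ k n, Measurable (S.gap k n)
  law_gap : ∀ k n, HasLaw (S.gap k n) (F k) P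
  law_gap_pos : ∀ k, F k (Set.Iic 0) = 0
  law_gap_continuous : ∀ k, Continuous (cdf (F k))
  indep_gap : iIndepFun (fun (p : Fin N × ℕ) (ω : Ω) => S.gap p.1 p.2 ω) P
  measurable_dest : ∀ k n, Measurable (S.dest k n)
  law_dest : ∀ k n j, P.real {ω | S.dest k n ω = j} = R k j
  routing_diag : ∀ k, R k k = 0
  indep_dest : iIndepFun (fun (p : Fin N × ℕ) (ω : Ω) => S.dest p.1 p.2 ω) P
  /-- `x(0)` is independent of the free dynamics, the flows and the routing. -/
  indep_init : IndepFun S.init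
    (fun ω => ((fun j t => S.free j t ω : Fin N → ℝ≥0 → EuclideanSpace ℝ (Fin d)),
      (fun k n => S.gap k n ω : Fin N → ℕ → ℝ),
      (fun k n => S.dest k n ω : Fin N → ℕ → Fin N))) P
  /-- The free dynamics are independent of the flows and the routing. -/
  indep_free_sync : IndepFun
    (fun ω => (fun j t => S.free j t ω : Fin N → ℝ≥0 → EuclideanSpace ℝ (Fin d)))
    (fun ω => ((fun k n => S.gap k n ω : Fin N → ℕ → ℝ),
      (fun k n => S.dest k n ω : Fin N → ℕ → Fin N))) P
  /-- The flows are independent of the routing. -/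
  indep_gap_dest : IndepFun
    (fun ω => (fun k n => S.gap k n ω : Fin N → ℕ → ℝ))
    (fun ω => (fun k n => S.dest k n ω : Fin N → ℕ → Fin N)) P

/-- The uniform routing matrix: `r_{kj} = 1 / (N - 1)` for `j ≠ k` and `r_{kk} = 0`. -/
noncomputable def uniformRouting (N : ℕ) : Matrix (Fin N) (Fin N) ℝ :=
  fun k j => if j = k then 0 else 1 / ((N : ℝ) - 1)

/-- The general symmetric model `GGS_N(ψ; F)`: equal Lévy exponents, equal inter-event laws,
uniform routing, and an initial law that is invariant under permutations of the components. -/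
structure IsGGS {Ω : Type*} [MeasurableSpace Ω] (P : Measure Ω) {N d : ℕ}
    (S : Ingredients Ω N d) (ψ : EuclideanSpace ℝ (Fin d) → ℂ) (F : Measure ℝ) : Prop
    extends IsGG P S (fun _ => ψ) (fun _ => F) (uniformRouting N) where
  exchangeable_init : ∀ π : Equiv.Perm (Fin N),
    P.map (fun ω => S.init ω ∘ π) = P.map S.init

/-- The Markovian symmetric model `GMS_N(ψ; m)`: inter-event times are exponential with mean `m`
(`expMeasure` is parametrized by the rate). -/
def IsGMS {Ω : Type*} [MeasurableSpace Ω] (P : Measure Ω) {N d : ℕ}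
    (S : Ingredients Ω N d) (ψ : EuclideanSpace ℝ (Fin d) → ℂ) (m : ℝ) : Prop :=
  IsGGS P S ψ (expMeasure (1 / m))

/-- `η(u) = -2 Re ψ(u)`, where `ψ` is the Lévy exponent of the free dynamics. -/
noncomputable def eta {d : ℕ} (ψ : EuclideanSpace ℝ (Fin d) → ℂ)
    (u : EuclideanSpace ℝ (Fin d)) : ℝ := -2 * (ψ u).re

/-- `w_N = 2 / ((N - 1) m)`. -/
noncomputable def wN (N : ℕ) (m : ℝ) : ℝ := 2 / (((N : ℝ) - 1) * m)

/-- `q_N(u) = η(u) + w_N`. -/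
noncomputable def qN {d : ℕ} (N : ℕ) (m : ℝ) (ψ : EuclideanSpace ℝ (Fin d) → ℂ)
    (u : EuclideanSpace ℝ (Fin d)) : ℝ := eta ψ u + wN N m

end SyncModel

namespace SyncModel

/-! ### Synchronization data -/

/-! Conditionally on the synchronization data (message times and recipients), the quantities `E
exp(i⟨u, x_a - x_b⟩)` form a matrix indexed by pairs `(a, b)` with a closed deterministic evolution.
Free motion of duration `s` multiplies each off-diagonal entry by `exp(-η s)`, since two independent
Lévy components contribute the exponents `ψ(u)` and `ψ(-u)`, whose sum is `2 Re ψ(u) = -η(u)`. A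
jump along a map `f` replaces the entry `(a, b)` by the entry `(f a, f b)`. This is `pairCorr`, and
`chi_eq_meanCorr` identifies `χ` with its mean over the data.

By exchangeability the initial matrix is `1` on the diagonal and a constant `c` off it. Averaging
over a uniform sender and recipient keeps this shape and maps `c` to `c + p (1 - c)` with `p = 2 /
(N (N - 1))`: among the `N (N - 1)` ordered pairs, exactly two merge `a` and `b`
(`sum_uniformRouting_constCorr`).

The first message arrives at rate `L = N / m`, and by lack of memory the data seen after it have the
original law. Hence the mean correlation satisfies a renewal equation over the first message time
(`meanCorr_renewal`). The solution `relax` of `y' = -(η + w) y + w` satisfies the same equation,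
because `L p = w` (`relax_renewal`). On `[0, t]` the renewal operator contracts bounded functions of
the time and of `c` in the unit disc by the factor `1 - exp(-L t) < 1`, so the two coincide
(`meanCorr_eq_relax`).

The differential equation and the limit `w / (η + w)` are read off from the explicit formula. The
limit is continuous in `u`, so Lévy's continuity theorem supplies the limit law.

A technical point is that the free paths are evaluated at random times. These times are first
rounded up to a countable grid, where measurability and Fubini are available, and right-continuity
removes the grid in the limit. -/

/-- The inter-event times and the recipients of all messages. -/
abbrev SyncData (N : ℕ) := (Fin N × ℕ → ℝ) × (Fin N × ℕ → Fin N)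

/-- The ingredients on the space of synchronization data, without initial state and free motion. -/
def syncIngredients (N : ℕ) : Ingredients (SyncData N) N 0 where
  init := fun _ _ => 0
  free := fun _ _ _ => 0
  gap := fun k n σ => σ.1 (k, n)
  dest := fun k n σ => σ.2 (k, n)

namespace SyncData

variable {N : ℕ}

/-- The time of the message `p.2` of the component `p.1`. -/
noncomputable def msgTime (σ : SyncData N) (p : Fin N × ℕ) : ℝ :=
  (syncIngredients N).sendTime p.1 p.2 σ

/-- The synchronization epochs. -/
noncomputable def epoch (σ : SyncData N) : ℕ → ℝ := (syncIngredients N).epoch σ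

/-- The synchronization map at time `s`. -/
noncomputable def jumpMap (σ : SyncData N) (s : ℝ) : Fin N → Fin N :=
  (syncIngredients N).jumpMap σ s

/-- The number of jumps that act on the state at time `t`. -/
noncomputable def jumpsBefore (σ : SyncData N) (t : ℝ) : ℕ := sInf {q : ℕ | t ≤ σ.epoch (q + 1)}

lemma msgTime_eq (σ : SyncData N) (p : Fin N × ℕ) :
    σ.msgTime p = ∑ i ∈ Finset.range (p.2 + 1), σ.1 (p.1, i) := rfl

@[simp] lemma epoch_zero (σ : SyncData N) : σ.epoch 0 = 0 := rfl

lemma epoch_succ (σ : SyncData N) (q : ℕ) :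
    σ.epoch (q + 1) = sInf {s : ℝ | σ.epoch q < s ∧ ∃ p, σ.msgTime p = s} := by
  have : {s : ℝ | σ.epoch q < s ∧ ∃ p, σ.msgTime p = s} =
      {s : ℝ | (syncIngredients N).epoch σ q < s ∧
        ∃ k n, (syncIngredients N).sendTime k n σ = s} := by
    ext s
    simp [epoch, msgTime]
  rw [this]
  rfl

/-- Data with positive inter-event times, without simultaneous messages, and with finitely many
messages in bounded time. -/
structure IsRegular (σ : SyncData N) : Prop where
  gap_pos : ∀ p, 0 < σ.1 p
  injective : Function.Injective σ.msgTime
  tendsto : ∀ k, Tendsto (fun n => σ.msgTime (k, n)) atTop atTop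

lemma jumpMap_of_not_exists {σ : SyncData N} {s : ℝ} (h : ¬ ∃ p, σ.msgTime p = s) :
    σ.jumpMap s = id := by
  unfold jumpMap Ingredients.jumpMap
  exact dif_neg h

/-- `jumpMap` selects a message by choice; injectivity leaves only one candidate. -/
lemma jumpMap_msgTime {σ : SyncData N} (hσ : Function.Injective σ.msgTime) (p : Fin N × ℕ) :
    σ.jumpMap (σ.msgTime p) = pairMap p.1 (σ.2 p) := by
  have h : ∃ p' : Fin N × ℕ, (syncIngredients N).sendTime p'.1 p'.2 σ = σ.msgTime p := ⟨p, rfl⟩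
  have h1 : h.choose = p := hσ h.choose_spec
  unfold jumpMap Ingredients.jumpMap
  rw [dif_pos h, h1]
  rfl

lemma IsRegular.finite_le {σ : SyncData N} (hσ : σ.IsRegular) (C : ℝ) :
    {p | σ.msgTime p ≤ C}.Finite := by
  have h : ∀ k, ∃ n₀, ∀ n ≥ n₀, C < σ.msgTime (k, n) := fun k =>
    eventually_atTop.1 ((hσ.tendsto k).eventually_gt_atTop C)
  choose n₀ hn₀ using h
  refine Set.Finite.subset (Finset.univ.finite_toSet.biUnion (t := fun k : Fin N =>
    ((Finset.range (n₀ k)).image (fun n => (k, n)) : Set (Fin N × ℕ)))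
    fun k _ => Finset.finite_toSet _) ?_
  rintro ⟨k, n⟩ hp
  simp only [Set.mem_iUnion]
  refine ⟨k, by simp, ?_⟩
  by_contra hn
  have : n₀ k ≤ n := by simpa using hn
  exact absurd (hn₀ k n this) (not_lt.2 hp)

/-- Only finitely many messages precede any given one, so the infimum defining the next epoch is
attained. Regularity also provides a message after every epoch, which keeps `sInf ∅ = 0` from
occurring. -/
lemma IsRegular.isLeast_epoch {σ : SyncData N} (hN : 0 < N) (hσ : σ.IsRegular) (q : ℕ) :
    IsLeast {s : ℝ | σ.epoch q < s ∧ ∃ p, σ.msgTime p = s} (σ.epoch (q + 1)) := by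
  obtain ⟨n, hn⟩ := ((hσ.tendsto ⟨0, hN⟩).eventually_gt_atTop (σ.epoch q)).exists
  set p₀ : Fin N × ℕ := (⟨0, hN⟩, n)
  set B := {p | σ.epoch q < σ.msgTime p ∧ σ.msgTime p ≤ σ.msgTime p₀} with hB
  obtain ⟨p, hp, hmin⟩ := Set.exists_min_image B σ.msgTime
    ((hσ.finite_le (σ.msgTime p₀)).subset fun p hp => hp.2) ⟨p₀, hn, le_rfl⟩
  have hl : IsLeast {s : ℝ | σ.epoch q < s ∧ ∃ p, σ.msgTime p = s} (σ.msgTime p) := by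
    refine ⟨⟨hp.1, p, rfl⟩, ?_⟩
    rintro _ ⟨h1, p', rfl⟩
    rcases le_total (σ.msgTime p') (σ.msgTime p₀) with h2 | h2
    · exact hmin p' ⟨h1, h2⟩
    · exact hp.2.trans h2
  rw [epoch_succ, hl.csInf_eq]
  exact hl

lemma IsRegular.strictMono_epoch {σ : SyncData N} (hN : 0 < N) (hσ : σ.IsRegular) :
    StrictMono σ.epoch :=
  strictMono_nat_of_lt_succ fun q => (hσ.isLeast_epoch hN q).1.1

lemma IsRegular.epoch_nonneg {σ : SyncData N} (hN : 0 < N) (hσ : σ.IsRegular) (q : ℕ) :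
    0 ≤ σ.epoch q :=
  (hσ.strictMono_epoch hN).monotone (Nat.zero_le q)

/-- Epochs bounded by `C` would come from infinitely many distinct messages sent before `C`. -/
lemma IsRegular.exists_epoch_ge {σ : SyncData N} (hN : 0 < N) (hσ : σ.IsRegular) (C : ℝ) :
    ∃ q, C ≤ σ.epoch (q + 1) := by
  by_contra! h
  choose p hp using fun q => (hσ.isLeast_epoch hN q).1.2
  have hinj : Function.Injective p := fun a b hab => by
    have := (hσ.strictMono_epoch hN).injective ((hp a).symm.trans ((congrArg _ hab).trans (hp b)))
    omega
  exact (Set.infinite_range_of_injective hinj)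
    ((hσ.finite_le C).subset (by rintro _ ⟨q, rfl⟩; exact ((hp q).trans_lt (h q)).le))

/-- This follows from minimality of `sInf` alone, without regularity: if the set is empty, the
default index `0` has epoch `0`. -/
lemma epoch_jumpsBefore_le (σ : SyncData N) {t : ℝ} (ht : 0 ≤ t) :
    σ.epoch (σ.jumpsBefore t) ≤ t := by
  rcases h : σ.jumpsBefore t with _ | q
  · simpa using ht
  · by_contra! h1
    have : σ.jumpsBefore t ≤ q := Nat.sInf_le h1.le
    omega

/-! ### Restart after the first message -/

/-- Renumbering of the messages when the first message of `k` is removed. -/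
def shiftIndex (k : Fin N) (p : Fin N × ℕ) : Fin N × ℕ := if p.1 = k then (k, p.2 + 1) else p

/-- The data seen after the first message, sent by `k` at time `s`. -/
def restart (k : Fin N) (s : ℝ) (σ : SyncData N) : SyncData N :=
  (fun p => σ.1 (shiftIndex k p) - if p.1 ≠ k ∧ p.2 = 0 then s else 0,
    fun p => σ.2 (shiftIndex k p))

lemma shiftIndex_injective (k : Fin N) : Function.Injective (shiftIndex k) := by
  rintro ⟨a, n⟩ ⟨b, n'⟩ h
  unfold shiftIndex at h
  split_ifs at h <;> grind

lemma exists_shiftIndex {k : Fin N} {p : Fin N × ℕ} (hp : p ≠ (k, 0)) :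
    ∃ p', shiftIndex k p' = p := by
  obtain ⟨a, n⟩ := p
  by_cases ha : a = k
  · subst ha
    rcases n with _ | n
    · exact absurd rfl hp
    · exact ⟨(a, n), by simp [shiftIndex]⟩
  · exact ⟨(a, n), by simp [shiftIndex, ha]⟩

lemma shiftIndex_ne (k : Fin N) (p : Fin N × ℕ) : shiftIndex k p ≠ (k, 0) := by
  unfold shiftIndex
  split_ifs with h
  · simp
  · grind

/-- For the sender `k` the first gap is dropped from the sum; for every other component the first
gap is shortened by the elapsed time. Both shift the message time by the same amount. -/
lemma msgTime_restart (σ : SyncData N) (k : Fin N) (p : Fin N × ℕ) :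
    (restart k (σ.1 (k, 0)) σ).msgTime p = σ.msgTime (shiftIndex k p) - σ.1 (k, 0) := by
  obtain ⟨a, n⟩ := p
  rw [msgTime_eq, msgTime_eq]
  by_cases ha : a = k
  · subst ha
    simp only [restart, shiftIndex, if_true]
    rw [Finset.sum_range_succ' _ (n + 1)]
    simp
  · simp only [restart, shiftIndex, ha, if_false]
    rw [Finset.sum_range_succ', Finset.sum_range_succ']
    simp only [ne_eq, ha, not_false_eq_true, Nat.add_eq_zero_iff, one_ne_zero, and_false, and_true,
      if_false, if_true]
    simp
    ring

lemma IsRegular.gap_le_msgTime {σ : SyncData N} (hσ : σ.IsRegular) (p : Fin N × ℕ) :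
    σ.1 (p.1, 0) ≤ σ.msgTime p := by
  rw [msgTime_eq]
  exact Finset.single_le_sum (f := fun i => σ.1 (p.1, i)) (fun i _ => (hσ.gap_pos _).le) (by simp)

lemma first_le_msgTime {σ : SyncData N} (hσ : σ.IsRegular) {k : Fin N}
    (hk : ∀ j, j ≠ k → σ.1 (k, 0) < σ.1 (j, 0)) (p : Fin N × ℕ) : σ.1 (k, 0) ≤ σ.msgTime p := by
  refine le_trans ?_ (hσ.gap_le_msgTime p)
  by_cases h : p.1 = k
  · rw [h]
  · exact (hk _ h).le

lemma epoch_one_of_first {σ : SyncData N} (hσ : σ.IsRegular) {k : Fin N}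
    (hk : ∀ j, j ≠ k → σ.1 (k, 0) < σ.1 (j, 0)) : σ.epoch 1 = σ.1 (k, 0) := by
  have h0 : σ.msgTime (k, 0) = σ.1 (k, 0) := by simp [msgTime_eq]
  have : IsLeast {s : ℝ | σ.epoch 0 < s ∧ ∃ p, σ.msgTime p = s} (σ.1 (k, 0)) := by
    refine ⟨⟨by simpa using hσ.gap_pos _, (k, 0), h0⟩, ?_⟩
    rintro _ ⟨-, p, rfl⟩
    exact first_le_msgTime hσ hk p
  rw [epoch_succ, this.csInf_eq]

lemma exists_msgTime_restart_iff {σ : SyncData N} {k : Fin N} {x : ℝ} (hx : σ.1 (k, 0) < x) :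
    (∃ p, (restart k (σ.1 (k, 0)) σ).msgTime p = x - σ.1 (k, 0)) ↔ ∃ p, σ.msgTime p = x := by
  constructor
  · rintro ⟨p, hp⟩
    rw [msgTime_restart] at hp
    exact ⟨shiftIndex k p, by linarith⟩
  · rintro ⟨p, rfl⟩
    have hp : p ≠ (k, 0) := by
      rintro rfl
      simp [msgTime_eq] at hx
    obtain ⟨p', rfl⟩ := exists_shiftIndex hp
    exact ⟨p', msgTime_restart σ k p'⟩

/-- `shiftIndex k` is a bijection onto the messages other than the first one, so the restarted flow
has the same message times, shifted, and each next-epoch minimum is shifted as well. -/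
lemma epoch_restart {σ : SyncData N} (hσ : σ.IsRegular) {k : Fin N}
    (hk : ∀ j, j ≠ k → σ.1 (k, 0) < σ.1 (j, 0)) (q : ℕ) :
    (restart k (σ.1 (k, 0)) σ).epoch q = σ.epoch (q + 1) - σ.1 (k, 0) := by
  have hN : 0 < N := k.pos
  induction q with
  | zero => simp [epoch_one_of_first hσ hk]
  | succ q ih =>
    have hge : σ.1 (k, 0) ≤ σ.epoch (q + 1) := by
      rw [← epoch_one_of_first hσ hk]
      exact (hσ.strictMono_epoch hN).monotone (by omega)
    have hl := hσ.isLeast_epoch hN (q + 1)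
    have : IsLeast {s : ℝ | (restart k (σ.1 (k, 0)) σ).epoch q < s ∧
        ∃ p, (restart k (σ.1 (k, 0)) σ).msgTime p = s} (σ.epoch (q + 1 + 1) - σ.1 (k, 0)) := by
      refine ⟨⟨by rw [ih]; linarith [hl.1.1],
        (exists_msgTime_restart_iff (hge.trans_lt hl.1.1)).2 hl.1.2⟩, ?_⟩
      rintro x ⟨hx, hp⟩
      rw [ih] at hx
      have hx' : σ.epoch (q + 1) < x + σ.1 (k, 0) := by linarith
      have := hl.2 ⟨hx', (exists_msgTime_restart_iff (hge.trans_lt hx')).1 (by simpa using hp)⟩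
      linarith
    rw [epoch_succ, this.csInf_eq]

lemma jumpMap_epoch_one {σ : SyncData N} (hσ : σ.IsRegular) {k : Fin N}
    (hk : ∀ j, j ≠ k → σ.1 (k, 0) < σ.1 (j, 0)) : σ.jumpMap (σ.epoch 1) = pairMap k (σ.2 (k, 0)) := by
  rw [epoch_one_of_first hσ hk, ← jumpMap_msgTime hσ.injective (k, 0)]
  simp [msgTime_eq]

lemma jumpMap_restart {σ : SyncData N} (hσ : σ.IsRegular) {k : Fin N}
    (hk : ∀ j, j ≠ k → σ.1 (k, 0) < σ.1 (j, 0)) (q : ℕ) :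
    (restart k (σ.1 (k, 0)) σ).jumpMap ((restart k (σ.1 (k, 0)) σ).epoch (q + 1)) =
      σ.jumpMap (σ.epoch (q + 1 + 1)) := by
  have hN : 0 < N := k.pos
  obtain ⟨p, hp⟩ := (hσ.isLeast_epoch hN (q + 1)).1.2
  have hlt : σ.1 (k, 0) < σ.epoch (q + 1 + 1) := by
    rw [← epoch_one_of_first hσ hk]
    exact hσ.strictMono_epoch hN (by omega)
  have hp0 : p ≠ (k, 0) := by
    rintro rfl
    rw [← hp] at hlt
    simp [msgTime_eq] at hlt
  obtain ⟨p', rfl⟩ := exists_shiftIndex hp0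
  have hinj : Function.Injective (restart k (σ.1 (k, 0)) σ).msgTime := by
    intro a b hab
    rw [msgTime_restart, msgTime_restart] at hab
    exact shiftIndex_injective k (hσ.injective (by linarith))
  rw [epoch_restart hσ hk, ← hp, ← msgTime_restart, jumpMap_msgTime hinj,
    jumpMap_msgTime hσ.injective]
  have : (shiftIndex k p').1 = p'.1 := by unfold shiftIndex; split_ifs with h <;> simp [h]
  rw [this]
  rfl

lemma jumpsBefore_of_first {σ : SyncData N} (hσ : σ.IsRegular) {k : Fin N}
    (hk : ∀ j, j ≠ k → σ.1 (k, 0) < σ.1 (j, 0)) {t : ℝ} (ht : σ.1 (k, 0) < t) :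
    σ.jumpsBefore t = (restart k (σ.1 (k, 0)) σ).jumpsBefore (t - σ.1 (k, 0)) + 1 := by
  have hN : 0 < N := k.pos
  unfold jumpsBefore
  -- Shifting the index inside `sInf` requires a positive infimum: `0` fails because `t` is past the
  -- first epoch, and nonemptiness excludes the default value of `sInf ∅`.
  have h1 : 0 < sInf {q : ℕ | t ≤ σ.epoch (q + 1)} := by
    rw [Nat.pos_iff_ne_zero, ne_eq, Nat.sInf_eq_zero, not_or]
    refine ⟨?_, (Set.nonempty_iff_ne_empty.1 (hσ.exists_epoch_ge hN t))⟩
    simp [epoch_one_of_first hσ hk, ht]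
  rw [← Nat.sInf_add (n := 1) h1]
  simp [epoch_restart hσ hk]

lemma jumpsBefore_of_le_first {σ : SyncData N} (hσ : σ.IsRegular) {k : Fin N}
    (hk : ∀ j, j ≠ k → σ.1 (k, 0) < σ.1 (j, 0)) {t : ℝ} (ht : t ≤ σ.1 (k, 0)) : σ.jumpsBefore t = 0 := by
  refine Nat.sInf_eq_zero.2 (Or.inl ?_)
  simp [epoch_one_of_first hσ hk, ht]

end SyncData

/-! ### Evolution of the pair correlations -/

/-- Damping of the off-diagonal entries during free motion of duration `s`. -/
noncomputable def decay {N : ℕ} (η s : ℝ) (M : Fin N → Fin N → ℂ) (a b : Fin N) : ℂ :=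
  (if a = b then 1 else (Real.exp (-(η * s)) : ℂ)) * M a b

/-- The pair correlations after `q` jumps at the times `τ 1, …, τ q`, by the maps
`f 0, …, f (q - 1)`. -/
noncomputable def pairCorr {N : ℕ} (η : ℝ) (τ : ℕ → ℝ) (f : ℕ → Fin N → Fin N)
    (M : Fin N → Fin N → ℂ) : ℕ → Fin N → Fin N → ℂ
  | 0 => M
  | q + 1 => fun a b => decay η (τ (q + 1) - τ q) (pairCorr η τ f M q) (f q a) (f q b)

/-- The definition adds the last jump, whereas the renewal argument removes the first one. Only
differences of times enter, so an arbitrary shift `c` is allowed. -/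
lemma pairCorr_succ' {N : ℕ} (η : ℝ) (τ : ℕ → ℝ) (f : ℕ → Fin N → Fin N)
    (M : Fin N → Fin N → ℂ) (c : ℝ) (q : ℕ) :
    pairCorr η τ f M (q + 1) = pairCorr η (fun i => τ (i + 1) - c) (fun i => f (i + 1))
      (fun a b => decay η (τ 1 - τ 0) M (f 0 a) (f 0 b)) q := by
  induction q with
  | zero => rfl
  | succ q ih =>
    rw [pairCorr, ih]
    simp [pairCorr]

/-- The pair correlations at time `t`, given the synchronization data. -/
noncomputable def SyncData.corrAt {N : ℕ} (η : ℝ) (σ : SyncData N) (t : ℝ)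
    (M : Fin N → Fin N → ℂ) : Fin N → Fin N → ℂ :=
  decay η (t - σ.epoch (σ.jumpsBefore t))
    (pairCorr η σ.epoch (fun q => σ.jumpMap (σ.epoch (q + 1))) M (σ.jumpsBefore t))

namespace SyncData

variable {N : ℕ} {σ : SyncData N} {k : Fin N}

/-- This is the pathwise renewal property: past the first message, the evolution is that of the
restarted data, started from the damped and merged matrix. -/
lemma corrAt_of_first_lt (hσ : σ.IsRegular) (hk : ∀ j, j ≠ k → σ.1 (k, 0) < σ.1 (j, 0))
    (η : ℝ) {t : ℝ} (ht : σ.1 (k, 0) < t) (M : Fin N → Fin N → ℂ) :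
    σ.corrAt η t M = (restart k (σ.1 (k, 0)) σ).corrAt η (t - σ.1 (k, 0))
      (fun a b => decay η (σ.1 (k, 0)) M (pairMap k (σ.2 (k, 0)) a)
        (pairMap k (σ.2 (k, 0)) b)) := by
  unfold corrAt
  rw [jumpsBefore_of_first hσ hk ht, pairCorr_succ' _ _ _ _ (σ.1 (k, 0))]
  have h1 : (restart k (σ.1 (k, 0)) σ).epoch = fun q => σ.epoch (q + 1) - σ.1 (k, 0) :=
    funext fun q => epoch_restart hσ hk q
  have h2 : (fun q => (restart k (σ.1 (k, 0)) σ).jumpMap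
      ((restart k (σ.1 (k, 0)) σ).epoch (q + 1))) = fun q => σ.jumpMap (σ.epoch (q + 1 + 1)) :=
    funext fun q => jumpMap_restart hσ hk q
  rw [h2, h1, zero_add, jumpMap_epoch_one hσ hk]
  simp [epoch_one_of_first hσ hk]

lemma corrAt_of_le_first (hσ : σ.IsRegular) (hk : ∀ j, j ≠ k → σ.1 (k, 0) < σ.1 (j, 0))
    (η : ℝ) {t : ℝ} (ht : t ≤ σ.1 (k, 0)) (M : Fin N → Fin N → ℂ) :
    σ.corrAt η t M = decay η t M := by
  unfold corrAt
  rw [jumpsBefore_of_le_first hσ hk ht]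
  simp [pairCorr]

end SyncData

namespace SyncData

variable {N : ℕ}

/-! ### The law of the synchronization data -/

/-- Insertion of a new first message of `k`. -/
def assemble {α : Type*} (k : Fin N) (x : α) (ρ : Fin N × ℕ → α) (p : Fin N × ℕ) : α :=
  if p.1 = k then (if p.2 = 0 then x else ρ (k, p.2 - 1)) else ρ p

@[simp] lemma assemble_first {α : Type*} (k : Fin N) (x : α) (ρ : Fin N × ℕ → α) :
    assemble k x ρ (k, 0) = x := by
  simp [assemble]

@[simp] lemma assemble_shiftIndex {α : Type*} (k : Fin N) (x : α) (ρ : Fin N × ℕ → α)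
    (p : Fin N × ℕ) : assemble k x ρ (shiftIndex k p) = ρ p := by
  obtain ⟨a, n⟩ := p
  by_cases h : a = k
  · subst h
    simp [assemble, shiftIndex]
  · simp [assemble, shiftIndex, h]

lemma assemble_of_ne {α : Type*} {k j : Fin N} (hj : j ≠ k) (x : α) (ρ : Fin N × ℕ → α) (n : ℕ) :
    assemble k x ρ (j, n) = ρ (j, n) := by
  simp [assemble, hj]

@[fun_prop]
lemma measurable_assemble {α : Type*} [MeasurableSpace α] (k : Fin N) :
    Measurable fun x : α × (Fin N × ℕ → α) => assemble k x.1 x.2 := by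
  refine measurable_pi_lambda _ fun p => ?_
  unfold assemble
  split_ifs <;> fun_prop

/-- Under a product law that only depends on the component, the first message of `k` is
independent of the other messages, and the latter have the same law as all messages. -/
lemma measurePreserving_assemble {α : Type*} [MeasurableSpace α] (μ : Fin N → Measure α)
    [∀ k, IsProbabilityMeasure (μ k)] (k : Fin N) :
    MeasurePreserving (fun x : α × (Fin N × ℕ → α) => assemble k x.1 x.2)
      ((μ k).prod (Measure.infinitePi fun p : Fin N × ℕ => μ p.1))
      (Measure.infinitePi fun p : Fin N × ℕ => μ p.1) := by
  classical
  refine ⟨measurable_assemble k, Measure.eq_infinitePi _ fun s t ht => ?_⟩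
  -- The preimage of a box is again a box: one side for the new first message, and the other sides
  -- renumbered by `shiftIndex`.
  have hpre : (fun x : α × (Fin N × ℕ → α) => assemble k x.1 x.2) ⁻¹' (Set.pi s t) =
      (if (k, 0) ∈ s then t (k, 0) else Set.univ) ×ˢ
        Set.pi (s.preimage (shiftIndex k) (shiftIndex_injective k).injOn)
          (fun p => t (shiftIndex k p)) := by
    ext ⟨x, ρ⟩
    simp only [Set.mem_preimage, Set.mem_pi, Set.mem_prod, Finset.mem_coe, Finset.mem_preimage]
    constructor
    · intro h
      refine ⟨?_, fun p hp => by simpa using h _ hp⟩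
      split_ifs with h0
      · simpa using h _ h0
      · trivial
    · rintro ⟨h0, h1⟩ p hp
      by_cases hpk : p = (k, 0)
      · subst hpk
        simpa [hp] using h0
      · obtain ⟨p', rfl⟩ := exists_shiftIndex hpk
        simpa using h1 p' hp
  rw [Measure.map_apply (measurable_assemble k)
    (MeasurableSet.pi (Finset.countable_toSet s) fun i _ => ht i), hpre, Measure.prod_prod,
    Measure.infinitePi_pi _ fun i _ => ht _]
  have h1 : ∀ p : Fin N × ℕ, (shiftIndex k p).1 = p.1 := fun p => by
    unfold shiftIndex; split_ifs with h <;> simp [h]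
  have h2 := Finset.prod_preimage' (shiftIndex k) s (shiftIndex_injective k).injOn
    (fun p => μ p.1 (t p))
  simp only [h1] at h2
  rw [h2]
  have h3 : (s.filter fun x => x ∈ Set.range (shiftIndex k)) = s.erase (k, 0) := by
    ext p
    simp only [Finset.mem_filter, Finset.mem_erase, Set.mem_range]
    constructor
    · rintro ⟨hp, p', rfl⟩
      exact ⟨shiftIndex_ne k p', hp⟩
    · rintro ⟨hp, hs⟩
      exact ⟨hs, exists_shiftIndex hp⟩
  rw [h3]
  split_ifs with h0
  · exact Finset.mul_prod_erase s (fun p => μ p.1 (t p)) h0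
  · rw [Finset.erase_eq_of_notMem h0, measure_univ, one_mul]

/-- Lack of memory of the exponential law. -/
lemma expMeasure_translate {r s : ℝ} (hs : 0 ≤ s) {T : Set ℝ}
    (hT : MeasurableSet T) :
    expMeasure r {x | s < x ∧ x - s ∈ T} = ENNReal.ofReal (Real.exp (-(r * s))) * expMeasure r T := by
  have hA : MeasurableSet {x : ℝ | s < x ∧ x - s ∈ T} :=
    measurableSet_Ioi.inter ((measurable_id.sub_const s) hT)
  have hpdf : ∀ A : Set ℝ, MeasurableSet A →
      expMeasure r A = ∫⁻ x, A.indicator (exponentialPDF r) x := fun A hA' => by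
    rw [lintegral_indicator hA', expMeasure, gammaMeasure, withDensity_apply _ hA']
    rfl
  rw [hpdf _ hA, hpdf _ hT, ← lintegral_const_mul' _ _ ENNReal.ofReal_ne_top,
    ← lintegral_add_right_eq_self _ s]
  -- The density used here is nonzero at `0`, where the strict inequality `s < s + x` fails, so this
  -- null point is discarded.
  have h0 : ∀ᵐ x : ℝ, x ≠ 0 := by simp [ae_iff]
  refine lintegral_congr_ae ?_
  filter_upwards [h0] with x hx
  by_cases hxT : x ∈ T
  · rcases lt_or_gt_of_ne hx with hx | hx
    · rw [Set.indicator_of_notMem (by simp; intro h; linarith), Set.indicator_of_mem hxT,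
        exponentialPDF_of_neg hx, mul_zero]
    · rw [Set.indicator_of_mem (by simpa using ⟨hx, hxT⟩), Set.indicator_of_mem hxT,
        exponentialPDF_of_nonneg (by linarith), exponentialPDF_of_nonneg hx.le,
        ← ENNReal.ofReal_mul (Real.exp_pos _).le]
      congr 1
      rw [mul_left_comm, ← Real.exp_add]
      ring_nf
  · rw [Set.indicator_of_notMem (by simp [hxT]), Set.indicator_of_notMem hxT, mul_zero]

/-- The law of the inter-event times of independent Poissonian flows. -/
noncomputable def gapLaw (N : ℕ) (r : ℝ) : Measure (Fin N × ℕ → ℝ) :=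
  Measure.infinitePi fun _ => expMeasure r

/-- The law of the recipients. -/
noncomputable def destLaw (ν : Fin N → Measure (Fin N)) : Measure (Fin N × ℕ → Fin N) :=
  Measure.infinitePi fun p => ν p.1

/-- The law of the synchronization data. -/
noncomputable def law (r : ℝ) (ν : Fin N → Measure (Fin N)) : Measure (SyncData N) :=
  (gapLaw N r).prod (destLaw ν)

/-- The waiting times left at time `s` if no component but `k` sends a message before `s`. -/
def residual (k : Fin N) (s : ℝ) (ρ : Fin N × ℕ → ℝ) (p : Fin N × ℕ) : ℝ :=
  ρ p - if p.1 ≠ k ∧ p.2 = 0 then s else 0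

@[fun_prop]
lemma measurable_residual (k : Fin N) (s : ℝ) : Measurable (residual k s) := by
  unfold residual
  fun_prop

/-- No component but `k` sends a message up to time `s`. -/
def quiet (k : Fin N) (s : ℝ) : Set (Fin N × ℕ → ℝ) := {ρ | ∀ j, j ≠ k → s < ρ (j, 0)}

lemma measurableSet_quiet (k : Fin N) (s : ℝ) : MeasurableSet (quiet k s) := by
  simp only [quiet, Set.ofPred_forall]
  exact MeasurableSet.iInter fun j => MeasurableSet.iInter fun _ =>
    measurableSet_lt measurable_const (measurable_pi_apply _)

/-- Lack of memory is applied to the independent first gaps of the `N - 1` components other than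
`k`, each contributing a factor `exp(-r s)`. All other gaps are left untouched. -/
lemma map_residual_restrict_quiet {r : ℝ} (hr : 0 < r) (k : Fin N) {s : ℝ} (hs : 0 ≤ s) :
    ((gapLaw N r).restrict (quiet k s)).map (residual k s) =
      ENNReal.ofReal (Real.exp (-(r * s))) ^ (N - 1) • gapLaw N r := by
  classical
  have := isProbabilityMeasure_expMeasure hr
  set c := ENNReal.ofReal (Real.exp (-(r * s))) with hc
  have hc0 : c ≠ 0 := by simp [hc, Real.exp_pos]
  have hct : c ≠ ⊤ := ENNReal.ofReal_ne_top
  -- After normalization the claim concerns a product measure, which is determined by its values on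
  -- finite boxes.
  suffices h : (c ^ (N - 1))⁻¹ • ((gapLaw N r).restrict (quiet k s)).map (residual k s) =
      gapLaw N r by
    nth_rewrite 2 [← h]
    rw [smul_smul, ENNReal.mul_inv_cancel (pow_ne_zero _ hc0) (ENNReal.pow_ne_top hct),
      one_smul]
  refine Measure.eq_infinitePi _ fun F t ht => ?_
  set B : Finset (Fin N × ℕ) := (Finset.univ.erase k).image fun j => (j, 0) with hB
  have hBmem : ∀ p, p ∈ B ↔ p.1 ≠ k ∧ p.2 = 0 := by
    rintro ⟨a, n⟩
    simp [hB, eq_comm]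
  have hBcard : B.card = N - 1 := by
    rw [hB, Finset.card_image_of_injective _ (fun a b h => by simpa using h)]
    simp
  -- The box constrains only `F`, while quietness constrains only `B`. Padding with `univ` lets both
  -- be expressed over `F ∪ B`.
  set t' : Fin N × ℕ → Set ℝ := fun p => if p ∈ F then t p else Set.univ with ht'
  have ht'm : ∀ p, MeasurableSet (t' p) := fun p => by
    simp only [ht']; split_ifs
    exacts [ht p, MeasurableSet.univ]
  set u : Fin N × ℕ → Set ℝ := fun p => if p ∈ B then {x | s < x ∧ x - s ∈ t' p} else t' p with hu
  have hum : ∀ p, MeasurableSet (u p) := fun p => by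
    simp only [hu]; split_ifs
    exacts [measurableSet_Ioi.inter ((measurable_id.sub_const s) (ht'm p)), ht'm p]
  have hset : residual k s ⁻¹' (Set.pi F t) ∩ quiet k s = Set.pi ((F ∪ B : Finset _) : Set _) u := by
    ext ρ
    simp only [Set.mem_inter_iff, Set.mem_preimage, Set.mem_pi, Finset.mem_coe, quiet,
      Set.mem_ofPred_eq, residual, Finset.mem_union, hu, ht', ← hBmem]
    constructor
    · rintro ⟨h1, h2⟩ p hp
      by_cases hpB : p ∈ B
      · have hs' : s < ρ p := by
          have := h2 p.1 ((hBmem p).1 hpB).1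
          rwa [← ((hBmem p).1 hpB).2] at this
        simp only [hpB, if_true]
        refine ⟨hs', ?_⟩
        split_ifs with hpF
        · simpa [hpB] using h1 p hpF
        · trivial
      · have hpF : p ∈ F := by tauto
        simpa [hpB, hpF] using h1 p hpF
    · intro h
      refine ⟨fun p hp => ?_, fun j hj => ?_⟩
      · have := h p (Or.inl hp)
        by_cases hpB : p ∈ B
        · simp only [hpB, if_true, hp] at this ⊢
          exact this.2
        · simpa [hpB, hp] using this
      · have hjB : (j, 0) ∈ B := (hBmem _).2 ⟨hj, rfl⟩
        have := h (j, 0) (Or.inr hjB)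
        simp only [hjB, if_true] at this
        exact this.1
  have hval : ∀ p, expMeasure r (u p) = (if p ∈ B then c else 1) * expMeasure r (t' p) := fun p => by
    simp only [hu]
    split_ifs
    · exact expMeasure_translate hs (ht'm p)
    · rw [one_mul]
  have hprod : ∏ p ∈ F ∪ B, expMeasure r (u p) = c ^ (N - 1) * ∏ p ∈ F, expMeasure r (t p) := by
    simp_rw [hval, Finset.prod_mul_distrib]
    congr 1
    · rw [Finset.prod_ite_mem, Finset.inter_eq_right.2 Finset.subset_union_right,
        Finset.prod_const, hBcard]
    · rw [← Finset.prod_subset (Finset.subset_union_left (s₁ := F) (s₂ := B))]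
      · exact Finset.prod_congr rfl fun p hp => by simp [ht', hp]
      · intro p _ hp
        simp [ht', hp]
  have hbox : MeasurableSet (Set.pi (F : Set (Fin N × ℕ)) t) :=
    MeasurableSet.pi (Finset.countable_toSet F) fun i _ => ht i
  rw [Measure.smul_apply, Measure.map_apply (measurable_residual k s) hbox,
    Measure.restrict_apply (measurable_residual k s hbox), hset, gapLaw,
    Measure.infinitePi_pi _ fun i _ => hum i, hprod, smul_eq_mul, ← mul_assoc,
    ENNReal.inv_mul_cancel (pow_ne_zero _ hc0) (ENNReal.pow_ne_top hct), one_mul]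

end SyncData

/-! ### Product rearrangement and integration against the exponential law. -/

lemma measurePreserving_prodProdProdComm {α β γ δ : Type*} [MeasurableSpace α] [MeasurableSpace β]
    [MeasurableSpace γ] [MeasurableSpace δ] (a : Measure α) (b : Measure β) (c : Measure γ)
    (d : Measure δ) [SFinite a] [SFinite b] [SFinite c] [SFinite d] :
    MeasurePreserving (fun x : (α × β) × γ × δ => ((x.1.1, x.2.1), (x.1.2, x.2.2)))
      ((a.prod b).prod (c.prod d)) ((a.prod c).prod (b.prod d)) := by
  have h1 := measurePreserving_prodAssoc a b (c.prod d)
  have h2 := (measurePreserving_prodAssoc b c d).symm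
  have h3 := (Measure.measurePreserving_swap (μ := b) (ν := c)).prod (MeasurePreserving.id d)
  have h4 := measurePreserving_prodAssoc c b d
  have h5 := (measurePreserving_prodAssoc a c (b.prod d)).symm
  exact h5.comp (((MeasurePreserving.id a).prod (h4.comp (h3.comp h2))).comp h1)

lemma integral_expMeasure {E : Type*} [NormedAddCommGroup E] [NormedSpace ℝ E] {r : ℝ}
    (hr : 0 < r) (f : ℝ → E) :
    ∫ x, f x ∂expMeasure r = ∫ x in Set.Ioi 0, (r * Real.exp (-(r * x))) • f x := by
  have h : ∀ᵐ x : ℝ, exponentialPDF r x < ⊤ := ae_of_all _ fun x => by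
    simp [exponentialPDF]
  have hm : Measurable (exponentialPDF r) := (measurable_exponentialPDFReal r).ennreal_ofReal
  have : ∫ x, f x ∂expMeasure r = ∫ x, (exponentialPDF r x).toReal • f x :=
    integral_withDensity_eq_integral_toReal_smul hm h f
  rw [this, ← integral_indicator measurableSet_Ioi]
  have h0 : ∀ᵐ x : ℝ, x ≠ 0 := by simp [ae_iff]
  refine integral_congr_ae ?_
  filter_upwards [h0] with x hx
  rcases lt_or_gt_of_ne hx with hx | hx
  · rw [exponentialPDF_of_neg hx, Set.indicator_of_notMem (by simpa using hx.le)]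
    simp
  · rw [exponentialPDF_of_nonneg hx.le, Set.indicator_of_mem (by simpa using hx),
      ENNReal.toReal_ofReal (by positivity)]

lemma integrableOn_of_integrable_expMeasure {E : Type*} [NormedAddCommGroup E] [NormedSpace ℝ E]
    {r : ℝ} (hr : 0 < r) {f : ℝ → E} (hf : Integrable f (expMeasure r)) :
    IntegrableOn (fun x => (r * Real.exp (-(r * x))) • f x) (Set.Ioi 0) := by
  have h : ∀ᵐ x : ℝ, exponentialPDF r x < ⊤ := ae_of_all _ fun x => by
    simp [exponentialPDF]
  have hm : Measurable (exponentialPDF r) := (measurable_exponentialPDFReal r).ennreal_ofReal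
  have h1 : Integrable (fun x => (exponentialPDF r x).toReal • f x) :=
    (integrable_withDensity_iff_integrable_smul' hm h).1 hf
  refine (h1.integrableOn (s := Set.Ioi 0)).congr_fun (fun x hx => ?_) measurableSet_Ioi
  have hx' : 0 < x := hx
  simp only
  rw [exponentialPDF_of_nonneg hx'.le, ENNReal.toReal_ofReal (by positivity)]

lemma expMeasure_absolutelyContinuous (r : ℝ) : expMeasure r ≪ volume :=
  withDensity_absolutelyContinuous _ _

instance (r : ℝ) : NullSingletonClass (expMeasure r) :=
  ⟨fun _ => expMeasure_absolutelyContinuous r (measure_singleton _)⟩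

lemma ae_pos_expMeasure (r : ℝ) : ∀ᵐ x ∂expMeasure r, 0 < x := by
  have hm : Measurable (gammaPDF 1 r) := (measurable_gammaPDFReal 1 r).ennreal_ofReal
  have h0 : ∀ᵐ x : ℝ, x ≠ 0 := by simp [ae_iff]
  rw [expMeasure, gammaMeasure, ae_withDensity_iff hm]
  filter_upwards [h0] with x hx hpdf
  by_contra h
  exact hpdf (gammaPDF_of_neg (lt_of_le_of_ne (not_lt.1 h) hx))

/-! ### Decomposition at the first message. -/

namespace SyncData

variable {N : ℕ}

/-- The first message is sent by `k`. -/
def first (k : Fin N) : Set (SyncData N) := {σ | ∀ j, j ≠ k → σ.1 (k, 0) < σ.1 (j, 0)}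

lemma measurableSet_first (k : Fin N) : MeasurableSet (first k) := by
  simp only [first, Set.ofPred_forall]
  exact MeasurableSet.iInter fun j => MeasurableSet.iInter fun _ =>
    measurableSet_lt (by fun_prop) (by fun_prop)

section

variable {r : ℝ} (ν : Fin N → Measure (Fin N)) [∀ k, IsProbabilityMeasure (ν k)]

lemma isProbabilityMeasure_law (hr : 0 < r) : IsProbabilityMeasure (law r ν) := by
  have := isProbabilityMeasure_expMeasure hr
  unfold law gapLaw destLaw
  infer_instance

lemma measurePreserving_assemble_law (hr : 0 < r) (k : Fin N) :
    MeasurePreserving (fun x : (ℝ × Fin N) × SyncData N =>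
      (assemble k x.1.1 x.2.1, assemble k x.1.2 x.2.2))
      (((expMeasure r).prod (ν k)).prod (law r ν)) (law r ν) := by
  have := isProbabilityMeasure_expMeasure hr
  have h1 := measurePreserving_assemble (fun _ : Fin N => expMeasure r) k
  have h2 := measurePreserving_assemble ν k
  exact (h1.prod h2).comp (measurePreserving_prodProdProdComm _ _ _ _)

lemma map_residual_law (hr : 0 < r) (k : Fin N) {s : ℝ} (hs : 0 ≤ s) :
    ((law r ν).restrict (quiet k s ×ˢ Set.univ)).map (Prod.map (residual k s) id) =
      ENNReal.ofReal (Real.exp (-(r * s))) ^ (N - 1) • law r ν := by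
  have := isProbabilityMeasure_expMeasure hr
  have : SFinite (gapLaw N r) := by unfold gapLaw; infer_instance
  have : SFinite (destLaw ν) := by unfold destLaw; infer_instance
  rw [law, ← Measure.prod_restrict, ← Measure.map_prod_map _ _ (measurable_residual k s)
    measurable_id, map_residual_restrict_quiet hr k hs, Measure.map_id, Measure.restrict_univ,
    Measure.prod_smul_left]

/-- Decomposition at the first message, if it is sent by `k`. -/
lemma setIntegral_first (hr : 0 < r) (hreg : ∀ᵐ σ ∂law r ν, σ.IsRegular) (k : Fin N)
    {H : SyncData N → ℂ} (hH : Integrable H (law r ν)) {Φ : ℝ → Fin N → SyncData N → ℂ}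
    (hΦ : ∀ s j, AEStronglyMeasurable (Φ s j) (law r ν))
    (hHΦ : ∀ σ : SyncData N, σ.IsRegular → σ ∈ first k →
      H σ = Φ (σ.1 (k, 0)) (σ.2 (k, 0)) (restart k (σ.1 (k, 0)) σ)) :
    IntegrableOn (fun s : ℝ => (r * Real.exp (-(N * r * s))) •
        ∫ j, (∫ σ, Φ s j σ ∂law r ν) ∂ν k) (Set.Ioi 0) ∧
      ∫ σ in first k, H σ ∂law r ν = ∫ s in Set.Ioi (0 : ℝ),
        (r * Real.exp (-(N * r * s))) • ∫ j, (∫ σ, Φ s j σ ∂law r ν) ∂ν k := by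
  have := isProbabilityMeasure_expMeasure hr
  have := isProbabilityMeasure_law ν hr
  have hmp := measurePreserving_assemble_law ν hr k
  have hind : Integrable ((first k).indicator H) (law r ν) :=
    hH.indicator (measurableSet_first k)
  have hint : Integrable (fun x : (ℝ × Fin N) × SyncData N => (first k).indicator H
      (assemble k x.1.1 x.2.1, assemble k x.1.2 x.2.2))
      (((expMeasure r).prod (ν k)).prod (law r ν)) :=
    hmp.integrable_comp_of_integrable hind
  have hNk : ((N - 1 : ℕ) : ℝ) = N - 1 := by
    have : 1 ≤ N := k.pos
    push_cast [this]; ring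
  -- With the first message `(s, j)` of `k` fixed, the event that `k` sends first says that the
  -- others are quiet up to `s`. On it the restarted data are the residual data, so integrating out
  -- the rest gives the factor `exp(-(N - 1) r s)`.
  have hinner : ∀ᵐ y ∂(expMeasure r).prod (ν k),
      ∫ x, (first k).indicator H (assemble k y.1 x.1, assemble k y.2 x.2) ∂law r ν =
        Real.exp (-((N - 1) * r * y.1)) • ∫ σ, Φ y.1 y.2 σ ∂law r ν := by
    have h1 := Measure.ae_ae_of_ae_prod (hmp.quasiMeasurePreserving.ae hreg)
    filter_upwards [h1] with y hy
    obtain ⟨s, j⟩ := y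
    have hs : 0 ≤ s := by
      obtain ⟨x, hx⟩ := hy.exists
      simpa using (hx.gap_pos (k, 0)).le
    have h2 : ∀ᵐ x ∂law r ν, (first k).indicator H (assemble k s x.1, assemble k j x.2) =
        (quiet k s ×ˢ Set.univ).indicator
          (fun x => Φ s j (Prod.map (residual k s) id x)) x := by
      filter_upwards [hy] with x hx
      have hiff : ((assemble k s x.1, assemble k j x.2) : SyncData N) ∈ first k ↔
          x ∈ quiet k s ×ˢ (Set.univ : Set (Fin N × ℕ → Fin N)) := by
        simp only [first, quiet, Set.mem_ofPred_eq, assemble_first, Set.mem_prod, Set.mem_univ,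
          and_true]
        refine forall_congr' fun i => forall_congr' fun hi => ?_
        rw [assemble_of_ne hi]
      by_cases hmem : x ∈ quiet k s ×ˢ (Set.univ : Set (Fin N × ℕ → Fin N))
      · rw [Set.indicator_of_mem hmem, Set.indicator_of_mem (hiff.2 hmem),
          hHΦ _ hx (hiff.2 hmem)]
        simp only [assemble_first]
        congr 1
        simp [restart, residual, Prod.map, funext_iff]
      · rw [Set.indicator_of_notMem hmem, Set.indicator_of_notMem (mt hiff.1 hmem)]
    have hmap := map_residual_law ν hr k hs
    have hΦ' : AEStronglyMeasurable (Φ s j)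
        (((law r ν).restrict (quiet k s ×ˢ Set.univ)).map (Prod.map (residual k s) id)) := by
      rw [hmap]
      exact (hΦ s j).mono_ac Measure.smul_absolutelyContinuous
    rw [integral_congr_ae h2,
      integral_indicator ((measurableSet_quiet k s).prod MeasurableSet.univ),
      ← integral_map (by fun_prop) hΦ', hmap, integral_smul_measure]
    congr 1
    rw [ENNReal.toReal_pow, ENNReal.toReal_ofReal (Real.exp_pos _).le, ← Real.exp_nat_mul, hNk]
    ring_nf
  have hcomp := integral_map hmp.aemeasurable (by rw [hmp.map_eq]; exact hind.1)
  rw [hmp.map_eq] at hcomp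
  have hint2 := hint.integral_prod_left.congr hinner
  -- The exponential density of the own gap and the survival probability of the other `N - 1`
  -- components combine into `r exp(-N r s)`.
  have hdens : ∀ s : ℝ, (r * Real.exp (-(r * s))) • ∫ j, Real.exp (-((N - 1) * r * s)) •
      (∫ σ, Φ s j σ ∂law r ν) ∂ν k =
      (r * Real.exp (-(N * r * s))) • ∫ j, (∫ σ, Φ s j σ ∂law r ν) ∂ν k := fun s => by
    rw [integral_smul, smul_smul]
    congr 1
    rw [mul_assoc, ← Real.exp_add]
    ring_nf
  constructor
  · exact (integrableOn_of_integrable_expMeasure hr hint2.integral_prod_left).congr_fun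
      (fun s _ => hdens s) measurableSet_Ioi
  · rw [← integral_indicator (measurableSet_first k), hcomp, integral_prod _ hint,
      integral_congr_ae hinner, integral_prod _ hint2, integral_expMeasure hr]
    exact setIntegral_congr_fun measurableSet_Ioi fun s _ => hdens s

/-! ### Almost sure regularity of the synchronization data. -/

/-- The inter-event times have the right law. -/
lemma measurePreserving_gap (hr : 0 < r) (p : Fin N × ℕ) :
    MeasurePreserving (fun σ : SyncData N => σ.1 p) (law r ν) (expMeasure r) := by
  have := isProbabilityMeasure_expMeasure hr
  have : IsProbabilityMeasure (destLaw ν) := by unfold destLaw; infer_instance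
  have : IsProbabilityMeasure (gapLaw N r) := by unfold gapLaw; infer_instance
  exact (measurePreserving_eval_infinitePi (fun _ : Fin N × ℕ => expMeasure r) p).comp
    measurePreserving_fst

lemma measurable_msgTime (p : Fin N × ℕ) : Measurable fun σ : SyncData N => σ.msgTime p := by
  simp only [msgTime_eq]
  fun_prop

/-- If everything but the first gap of `p.1` is fixed, a coincidence pins that gap to the single
value `b - a`, which an atomless law charges with probability zero. -/
lemma ae_msgTime_ne (hr : 0 < r) {p p' : Fin N × ℕ} (hp : p.1 ≠ p'.1) :
    ∀ᵐ σ ∂law r ν, σ.msgTime p ≠ σ.msgTime p' := by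
  have := isProbabilityMeasure_expMeasure hr
  have := isProbabilityMeasure_law ν hr
  have hmp := measurePreserving_assemble_law ν hr p.1
  have hm : MeasurableSet {σ : SyncData N | σ.msgTime p ≠ σ.msgTime p'} :=
    (measurableSet_eq_fun (measurable_msgTime p) (measurable_msgTime p')).compl
  rw [← hmp.map_eq, ae_map_iff hmp.aemeasurable hm,
    Measure.ae_prod_iff_ae_ae (by exact hmp.measurable hm),
    Measure.ae_ae_comm (by exact hmp.measurable hm)]
  refine ae_of_all _ fun y => ?_
  set a : ℝ := ∑ i ∈ Finset.range p.2, y.1 (p.1, i) with ha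
  set b : ℝ := ∑ i ∈ Finset.range (p'.2 + 1), y.1 (p'.1, i) with hb
  have h1 : ∀ᵐ x ∂(expMeasure r).prod (ν p.1), x.1 ≠ b - a :=
    measurePreserving_fst.quasiMeasurePreserving.ae
      (by simp [ae_iff] : ∀ᵐ x ∂expMeasure r, x ≠ b - a)
  filter_upwards [h1] with x hx h
  apply hx
  simp only [msgTime_eq] at h
  rw [Finset.sum_range_succ'] at h
  have e1 : ∀ i, assemble p.1 x.1 y.1 (p.1, i + 1) = y.1 (p.1, i) := fun i => by simp [assemble]
  have e2 : ∀ i, assemble p.1 x.1 y.1 (p'.1, i) = y.1 (p'.1, i) := fun i =>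
    assemble_of_ne (Ne.symm hp) _ _ _
  simp only [e1, e2, assemble_first, ← ha, ← hb] at h
  linarith

/-- The strong law of large numbers is applied to the gaps truncated at `1`: truncation makes
integrability immediate, the mean stays positive, and the truncated sums bound the message times
from below. -/
lemma ae_tendsto_msgTime (hr : 0 < r) (k : Fin N) :
    ∀ᵐ σ ∂law r ν, Tendsto (fun n => σ.msgTime (k, n)) atTop atTop := by
  have := isProbabilityMeasure_expMeasure hr
  have : IsProbabilityMeasure (destLaw ν) := by unfold destLaw; infer_instance
  have hev : ∀ p : Fin N × ℕ, MeasurePreserving (fun x : Fin N × ℕ → ℝ => x p)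
      (gapLaw N r) (expMeasure r) :=
    measurePreserving_eval_infinitePi (fun _ : Fin N × ℕ => expMeasure r)
  have : IsProbabilityMeasure (gapLaw N r) := by unfold gapLaw; infer_instance
  have hmin : Measurable fun x : ℝ => min x 1 := by fun_prop
  set X : ℕ → (Fin N × ℕ → ℝ) → ℝ := fun i x => min (x (k, i)) 1 with hX
  have hpos : ∀ i, ∀ᵐ x ∂gapLaw N r, 0 < X i x := fun i => by
    filter_upwards [(hev (k, i)).quasiMeasurePreserving.ae (ae_pos_expMeasure r)] with x hx
    exact lt_min hx one_pos
  have hint : Integrable (X 0) (gapLaw N r) := by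
    refine Integrable.of_bound (by fun_prop) 1 ?_
    filter_upwards [hpos 0] with x hx
    rw [Real.norm_of_nonneg hx.le]
    exact min_le_right _ _
  have hindep : iIndepFun (fun (p : Fin N × ℕ) (x : Fin N × ℕ → ℝ) => min (x p) 1) (gapLaw N r) :=
    iIndepFun_infinitePi (P := fun _ : Fin N × ℕ => expMeasure r)
      (X := fun _ (x : ℝ) => min x 1) fun _ => hmin
  have hident : ∀ i, IdentDistrib (X i) (X 0) (gapLaw N r) (gapLaw N r) := fun i => by
    have h0 : IdentDistrib (fun x : Fin N × ℕ → ℝ => x (k, i)) (fun x => x (k, 0))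
        (gapLaw N r) (gapLaw N r) :=
      ⟨(hev _).aemeasurable, (hev _).aemeasurable, by rw [(hev _).map_eq, (hev _).map_eq]⟩
    exact h0.comp hmin
  have hmean : 0 < ∫ x, X 0 x ∂gapLaw N r := by
    rw [integral_pos_iff_support_of_nonneg_ae ((hpos 0).mono fun x hx => hx.le) hint]
    have : gapLaw N r (Function.support (X 0)) = 1 :=
      (mem_ae_iff_prob_eq_one (measurableSet_support (by fun_prop))).1
        ((hpos 0).mono fun x hx => hx.ne')
    simp [this]
  have hslln := strong_law_ae_real X hint
    (fun i j hij => hindep.indepFun (by simpa using hij)) hident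
  have hlaw : ∀ᵐ x ∂gapLaw N r, Tendsto (fun n => ∑ i ∈ Finset.range (n + 1), x (k, i))
      atTop atTop := by
    filter_upwards [hslln] with x hx
    have h1 : Tendsto (fun n : ℕ => ∑ i ∈ Finset.range n, X i x) atTop atTop := by
      refine (hx.pos_mul_atTop hmean tendsto_natCast_atTop_atTop).congr' ?_
      filter_upwards [eventually_gt_atTop 0] with n hn
      have : (n : ℝ) ≠ 0 := by positivity
      field_simp
    refine tendsto_atTop_mono (fun n => ?_) ((tendsto_add_atTop_iff_nat 1).2 h1)
    exact Finset.sum_le_sum fun i _ => min_le_left _ _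
  exact measurePreserving_fst.quasiMeasurePreserving.ae hlaw

lemma ae_isRegular (hr : 0 < r) : ∀ᵐ σ ∂law r ν, σ.IsRegular := by
  have h1 : ∀ᵐ σ ∂law r ν, ∀ p, 0 < σ.1 p := ae_all_iff.2 fun p =>
    (measurePreserving_gap ν hr p).quasiMeasurePreserving.ae (ae_pos_expMeasure r)
  have h2 : ∀ᵐ σ ∂law r ν, ∀ p p', p.1 ≠ p'.1 → σ.msgTime p ≠ σ.msgTime p' :=
    ae_all_iff.2 fun p => ae_all_iff.2 fun p' => by
      by_cases h : p.1 = p'.1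
      · simp [h]
      · filter_upwards [ae_msgTime_ne ν hr h] with σ hσ _ using hσ
  have h3 : ∀ᵐ σ ∂law r ν, ∀ k, Tendsto (fun n => σ.msgTime (k, n)) atTop atTop :=
    ae_all_iff.2 fun k => ae_tendsto_msgTime ν hr k
  filter_upwards [h1, h2, h3] with σ h1 h2 h3
  refine ⟨h1, ?_, h3⟩
  rintro ⟨k, n⟩ ⟨k', n'⟩ h
  by_cases hk : k = k'
  · subst hk
    have hmono : StrictMono fun n => σ.msgTime (k, n) := strictMono_nat_of_lt_succ fun n => by
      simp only [msgTime_eq]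
      rw [Finset.sum_range_succ _ (n + 1)]
      linarith [h1 (k, n + 1)]
    rw [hmono.injective h]
  · exact absurd h (h2 _ _ hk)

end

end SyncData

/-! ### Measurability -/

/-- Evaluation at a random index is harmless when the indices are countable. This handles the random
number of jumps, the random jump maps, and later the random grid times. -/
lemma measurable_index {α β ι : Type*} [MeasurableSpace α] [MeasurableSpace β] [MeasurableSpace ι]
    [Countable ι] [MeasurableSingletonClass ι] {F : ι → α → β} (hF : ∀ i, Measurable (F i))
    {i : α → ι} (hi : Measurable i) : Measurable fun x => F (i x) x :=
  (measurable_from_prod_countable_right (f := fun p : ι × α => F p.1 p.2) hF).comp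
    (hi.prodMk measurable_id)

lemma measurable_nat_sInf {α : Type*} [MeasurableSpace α] {p : ℕ → α → Prop}
    (hp : ∀ n, MeasurableSet {x | p n x}) : Measurable fun x => sInf {n | p n x} := by
  refine measurable_to_countable' fun n => ?_
  -- The second set accounts for `sInf ∅ = 0`.
  have : (fun x => sInf {n | p n x}) ⁻¹' {n} =
      ({x | p n x} ∩ ⋂ m, ⋂ (_ : m < n), {x | p m x}ᶜ) ∪
        ({_x | n = 0} ∩ ⋂ m, {x | p m x}ᶜ) := by
    ext x
    simp only [Set.mem_preimage, Set.mem_singleton_iff, Set.mem_union, Set.mem_inter_iff,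
      Set.mem_ofPred_eq, Set.mem_iInter, Set.mem_compl_iff]
    constructor
    · rintro rfl
      by_cases h : {n | p n x}.Nonempty
      · exact Or.inl ⟨Nat.sInf_mem h, fun m hm => Nat.notMem_of_lt_sInf hm⟩
      · rw [Set.not_nonempty_iff_eq_empty] at h
        refine Or.inr ⟨by rw [h]; exact Nat.sInf_empty, fun m hm => ?_⟩
        have : m ∈ {n | p n x} := hm
        simp [h] at this
    · rintro (⟨h1, h2⟩ | ⟨rfl, h2⟩)
      · refine le_antisymm (Nat.sInf_le h1) (not_lt.1 fun h => ?_)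
        exact h2 _ h (Nat.sInf_mem (s := {n | p n x}) ⟨n, h1⟩)
      · have : {n | p n x} = ∅ := Set.eq_empty_of_forall_notMem h2
        rw [this]
        exact Nat.sInf_empty
  rw [this]
  refine MeasurableSet.union ((hp n).inter ?_) (MeasurableSet.inter (.const _) ?_)
  · exact MeasurableSet.iInter fun m => MeasurableSet.iInter fun _ => (hp m).compl
  · exact MeasurableSet.iInter fun m => (hp m).compl

lemma measurable_pairCorr {α : Type*} [MeasurableSpace α] {N : ℕ} (η : ℝ) {τ : ℕ → α → ℝ}
    (hτ : ∀ q, Measurable (τ q)) {f : ℕ → α → Fin N → Fin N} (hf : ∀ q, Measurable (f q))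
    (M : Fin N → Fin N → ℂ) (q : ℕ) (a b : Fin N) :
    Measurable fun x => pairCorr η (fun q => τ q x) (fun q => f q x) M q a b := by
  induction q generalizing a b with
  | zero => exact measurable_const
  | succ q ih =>
    have h1 : ∀ p : Fin N × Fin N, Measurable fun x =>
        decay η (τ (q + 1) x - τ q x) (pairCorr η (fun q => τ q x) (fun q => f q x) M q) p.1 p.2 :=
      fun p => by
        unfold decay
        refine Measurable.mul ?_ (ih _ _)
        split_ifs <;> fun_prop
    have h2 : Measurable fun x => (f q x a, f q x b) :=
      ((measurable_pi_apply a).comp (hf q)).prodMk ((measurable_pi_apply b).comp (hf q))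
    exact measurable_index h1 h2

namespace SyncData

variable {N : ℕ}

@[fun_prop]
lemma measurable_epoch (q : ℕ) : Measurable fun σ : SyncData N => σ.epoch q := by
  induction q with
  | zero => exact measurable_const
  | succ q ih =>
    refine measurable_of_Iio fun c => ?_
    -- The second set covers data without any message after epoch `q`, where the real `sInf ∅` is
    -- `0`.
    have : (fun σ : SyncData N => σ.epoch (q + 1)) ⁻¹' Set.Iio c =
        (⋃ p, {σ | σ.epoch q < σ.msgTime p} ∩ {σ | σ.msgTime p < c}) ∪
          ({_σ | 0 < c} ∩ ⋂ p, {σ | σ.epoch q < σ.msgTime p}ᶜ) := by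
      ext σ
      simp only [Set.mem_preimage, Set.mem_Iio, Set.mem_union, Set.mem_iUnion, Set.mem_inter_iff,
        Set.mem_ofPred_eq, Set.mem_iInter, Set.mem_compl_iff, not_lt, epoch_succ]
      by_cases h : {s : ℝ | σ.epoch q < s ∧ ∃ p, σ.msgTime p = s}.Nonempty
      · rw [csInf_lt_iff ⟨σ.epoch q, fun s hs => hs.1.le⟩ h]
        constructor
        · rintro ⟨_, ⟨h1, p, rfl⟩, h2⟩
          exact Or.inl ⟨p, h1, h2⟩
        · rintro (⟨p, h1, h2⟩ | ⟨-, h2⟩)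
          · exact ⟨_, ⟨h1, p, rfl⟩, h2⟩
          · obtain ⟨_, h1, p, rfl⟩ := h
            exact absurd h1 (not_lt.2 (h2 p))
      · rw [Set.not_nonempty_iff_eq_empty] at h
        have h2 : ∀ p, σ.msgTime p ≤ σ.epoch q := fun p => by
          by_contra! h3
          exact Set.eq_empty_iff_forall_notMem.1 h _ ⟨h3, p, rfl⟩
        rw [h, Real.sInf_empty]
        constructor
        · exact fun hc => Or.inr ⟨hc, h2⟩
        · rintro (⟨p, h1, -⟩ | ⟨hc, -⟩)
          · exact absurd h1 (not_lt.2 (h2 p))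
          · exact hc
    rw [this]
    refine MeasurableSet.union (MeasurableSet.iUnion fun p => ?_)
      ((MeasurableSet.const _).inter (MeasurableSet.iInter fun p => ?_))
    · exact (measurableSet_lt ih (measurable_msgTime p)).inter
        (measurableSet_lt (measurable_msgTime p) measurable_const)
    · exact (measurableSet_lt ih (measurable_msgTime p)).compl

lemma measurable_jumpsBefore (t : ℝ) : Measurable fun σ : SyncData N => σ.jumpsBefore t :=
  measurable_nat_sInf fun q => measurableSet_le measurable_const (measurable_epoch (q + 1))

open Classical in
/-- The map applied at the epoch `q + 1`, on regular data. -/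
noncomputable def jump (q : ℕ) (σ : SyncData N) : Fin N → Fin N :=
  if Function.Injective σ.msgTime then σ.jumpMap (σ.epoch (q + 1)) else id

lemma jump_eq {σ : SyncData N} (hσ : σ.IsRegular) (q : ℕ) :
    σ.jumpMap (σ.epoch (q + 1)) = jump q σ := by
  rw [jump, if_pos hσ.injective]

/-- On data with simultaneous messages `jumpMap` depends on an uncontrolled choice; `jump` replaces
it there by `id`, and elsewhere the sender is a countable measurable case distinction. -/
lemma measurable_jump (q : ℕ) : Measurable (jump (N := N) q) := by
  have hinj : MeasurableSet {σ : SyncData N | Function.Injective σ.msgTime} := by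
    have : {σ : SyncData N | Function.Injective σ.msgTime} =
        ⋂ p, ⋂ p', ⋂ (_ : p ≠ p'), {σ | σ.msgTime p = σ.msgTime p'}ᶜ := by
      ext σ
      simp only [Set.mem_ofPred_eq, Set.mem_iInter, Set.mem_compl_iff]
      exact ⟨fun h p p' hp => h.ne hp, fun h p p' hp => by_contra fun hne => h p p' hne hp⟩
    rw [this]
    exact MeasurableSet.iInter fun p => MeasurableSet.iInter fun p' => MeasurableSet.iInter fun _ =>
      (measurableSet_eq_fun (measurable_msgTime p) (measurable_msgTime p')).compl
  have hp : ∀ p : Fin N × ℕ, MeasurableSet {σ : SyncData N | σ.msgTime p = σ.epoch (q + 1)} :=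
    fun p => measurableSet_eq_fun (measurable_msgTime p) (measurable_epoch _)
  refine measurable_to_countable' fun f => ?_
  have : jump (N := N) q ⁻¹' {f} = ({σ | Function.Injective σ.msgTime} ∩
      ((⋃ p, {σ | σ.msgTime p = σ.epoch (q + 1)} ∩ {σ | pairMap p.1 (σ.2 p) = f}) ∪
        ((⋂ p, {σ | σ.msgTime p = σ.epoch (q + 1)}ᶜ) ∩ {_σ | id = f}))) ∪
      ({σ | Function.Injective σ.msgTime}ᶜ ∩ {_σ | id = f}) := by
    ext σ
    simp only [Set.mem_preimage, Set.mem_singleton_iff, Set.mem_union, Set.mem_inter_iff,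
      Set.mem_ofPred_eq, Set.mem_iInter, Set.mem_compl_iff, Set.mem_iUnion, jump]
    by_cases hi : Function.Injective σ.msgTime
    · simp only [hi, if_true, true_and, not_true, false_and, or_false]
      by_cases he : ∃ p, σ.msgTime p = σ.epoch (q + 1)
      · obtain ⟨p, hp⟩ := he
        rw [← hp, jumpMap_msgTime hi]
        constructor
        · exact fun h => Or.inl ⟨p, rfl, h⟩
        · rintro (⟨p', h1, h2⟩ | ⟨h1, -⟩)
          · rwa [← hi h1]
          · exact absurd rfl (h1 p)
      · rw [jumpMap_of_not_exists he]
        push Not at he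
        simp [he]
    · simp [hi]
  rw [this]
  refine MeasurableSet.union (hinj.inter (MeasurableSet.union (MeasurableSet.iUnion fun p => ?_)
    (MeasurableSet.inter (MeasurableSet.iInter fun p => (hp p).compl) (.const _))))
    (hinj.compl.inter (.const _))
  refine (hp p).inter ?_
  have h2 : Measurable fun σ : SyncData N => σ.2 p := by fun_prop
  exact h2 (measurableSet_eq_fun (measurable_of_countable _) measurable_const :
    MeasurableSet {j : Fin N | pairMap p.1 j = f})

/-- A measurable version of the pair correlations. -/
noncomputable def corrAt' (η : ℝ) (σ : SyncData N) (t : ℝ)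
    (M : Fin N → Fin N → ℂ) : Fin N → Fin N → ℂ :=
  decay η (t - σ.epoch (σ.jumpsBefore t))
    (pairCorr η σ.epoch (fun q => jump q σ) M (σ.jumpsBefore t))

lemma corrAt_eq {σ : SyncData N} (hσ : σ.IsRegular) (η t : ℝ) (M : Fin N → Fin N → ℂ) :
    σ.corrAt η t M = σ.corrAt' η t M := by
  unfold corrAt corrAt'
  simp_rw [jump_eq hσ]

lemma measurable_corrAt' (η t : ℝ) (M : Fin N → Fin N → ℂ) (a b : Fin N) :
    Measurable fun σ : SyncData N => σ.corrAt' η t M a b := by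
  have h : ∀ q, Measurable fun σ : SyncData N => decay η (t - σ.epoch q)
      (pairCorr η σ.epoch (fun q => jump q σ) M q) a b := fun q => by
    unfold decay
    refine Measurable.mul ?_ (measurable_pairCorr η measurable_epoch measurable_jump M q a b)
    split_ifs <;> fun_prop
  exact measurable_index h (measurable_jumpsBefore t)

lemma aestronglyMeasurable_corrAt {r : ℝ} (hr : 0 < r) (ν : Fin N → Measure (Fin N))
    [∀ k, IsProbabilityMeasure (ν k)] (η t : ℝ) (M : Fin N → Fin N → ℂ) (a b : Fin N) :
    AEStronglyMeasurable (fun σ : SyncData N => σ.corrAt η t M a b) (law r ν) := by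
  refine (measurable_corrAt' η t M a b).aestronglyMeasurable.congr ?_
  filter_upwards [ae_isRegular ν hr] with σ hσ
  rw [corrAt_eq hσ]

end SyncData

/-! ### The renewal equation -/

section Corr

variable {N : ℕ}

lemma norm_decay_le {η s : ℝ} (hη : 0 ≤ η) (hs : 0 ≤ s) {M : Fin N → Fin N → ℂ} {a b : Fin N}
    (hM : ‖M a b‖ ≤ 1) : ‖decay η s M a b‖ ≤ 1 := by
  rw [decay, norm_mul]
  refine mul_le_one₀ ?_ (norm_nonneg _) hM
  split_ifs
  · simp
  · rw [Complex.norm_real, Real.norm_of_nonneg (Real.exp_pos _).le, Real.exp_le_one_iff]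
    have := mul_nonneg hη hs
    linarith

lemma norm_pairCorr_le {η : ℝ} (hη : 0 ≤ η) {τ : ℕ → ℝ} (hτ : Monotone τ)
    (f : ℕ → Fin N → Fin N) {M : Fin N → Fin N → ℂ} (hM : ∀ a b, ‖M a b‖ ≤ 1) (q : ℕ)
    (a b : Fin N) : ‖pairCorr η τ f M q a b‖ ≤ 1 := by
  induction q generalizing a b with
  | zero => exact hM a b
  | succ q ih => exact norm_decay_le hη (sub_nonneg.2 (hτ (Nat.le_succ q))) (ih _ _)

/-- Linearity of the evolution in the initial matrix, here and in the next lemma, is what allows the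
average over sender and recipient to be carried out before evolving. -/
lemma decay_sum {ι : Type*} (s : Finset ι) (η t : ℝ) (w : ι → ℂ) (M : ι → Fin N → Fin N → ℂ) :
    decay η t (fun a b => ∑ i ∈ s, w i * M i a b) =
      fun a b => ∑ i ∈ s, w i * decay η t (M i) a b := by
  ext a b
  simp only [decay, Finset.mul_sum]
  exact Finset.sum_congr rfl fun i _ => by ring

lemma pairCorr_sum {ι : Type*} (s : Finset ι) (η : ℝ) (τ : ℕ → ℝ) (f : ℕ → Fin N → Fin N)
    (w : ι → ℂ) (M : ι → Fin N → Fin N → ℂ) (q : ℕ) :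
    pairCorr η τ f (fun a b => ∑ i ∈ s, w i * M i a b) q =
      fun a b => ∑ i ∈ s, w i * pairCorr η τ f (M i) q a b := by
  induction q with
  | zero => rfl
  | succ q ih =>
    ext a b
    simp only [pairCorr]
    rw [ih, decay_sum]

/-- The correlations of an exchangeable configuration. -/
def constCorr (N : ℕ) (c : ℂ) (a b : Fin N) : ℂ := if a = b then 1 else c

lemma norm_constCorr_le {c : ℂ} (hc : ‖c‖ ≤ 1) (a b : Fin N) : ‖constCorr N c a b‖ ≤ 1 := by
  unfold constCorr
  split_ifs
  · simp
  · exact hc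

lemma decay_constCorr (η s : ℝ) (c : ℂ) :
    decay η s (constCorr N c) = constCorr N (Real.exp (-(η * s)) * c) := by
  ext a b
  unfold decay constCorr
  split_ifs <;> simp

lemma sum_uniformRouting (hN : 2 ≤ N) (k : Fin N) : ∑ j, uniformRouting N k j = 1 := by
  have h2 : (2 : ℝ) ≤ N := by exact_mod_cast hN
  have : (N : ℝ) - 1 ≠ 0 := by linarith
  have h1 : ((N - 1 : ℕ) : ℝ) = N - 1 := by
    have : 1 ≤ N := by omega
    push_cast [this]; ring
  simp only [uniformRouting]
  rw [Finset.sum_ite, Finset.sum_const_zero, zero_add, Finset.sum_const, Finset.filter_ne',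
    Finset.card_erase_of_mem (Finset.mem_univ k)]
  simp [h1, this]

/-- A uniformly chosen synchronization preserves the correlations of exchangeable type. -/
lemma sum_uniformRouting_constCorr (hN : 2 ≤ N) (y : ℂ) (a b : Fin N) :
    ∑ k, ∑ j, (uniformRouting N k j : ℂ) * constCorr N y (pairMap k j a) (pairMap k j b) =
      N * constCorr N (y + 2 / (N * (N - 1)) * (1 - y)) a b := by
  have h2 : (2 : ℝ) ≤ N := by exact_mod_cast hN
  have hN0 : (N : ℂ) ≠ 0 := by
    have : N ≠ 0 := by omega
    exact_mod_cast this
  have hN1 : (N : ℂ) - 1 ≠ 0 := by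
    have : (N : ℝ) - 1 ≠ 0 := by linarith
    exact_mod_cast this
  have hsum : ∑ k : Fin N, ∑ j, (uniformRouting N k j : ℂ) = N := by
    have : ∑ k : Fin N, ∑ j, uniformRouting N k j = N := by simp [sum_uniformRouting hN]
    exact_mod_cast this
  by_cases hab : a = b
  · subst hab
    simp only [constCorr, if_true, mul_one, hsum]
  · have key : ∀ k j, (uniformRouting N k j : ℂ) * constCorr N y (pairMap k j a) (pairMap k j b) =
        (uniformRouting N k j : ℂ) * y + ((1 - y) / (N - 1)) *
          ((if k = b then (if j = a then 1 else 0) else 0) +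
            (if k = a then (if j = b then 1 else 0) else 0)) := fun k j => by
      by_cases hjk : j = k
      · subst hjk
        simp only [uniformRouting, if_true]
        split_ifs <;> simp_all
      · simp only [uniformRouting, hjk, if_false, constCorr, pairMap, Function.update_apply, id]
        push_cast
        by_cases h1 : a = j
        · subst h1
          have h3 : ¬ b = a := fun h => hab h.symm
          by_cases h4 : k = b
          · subst h4
            simp [h3]
            field_simp
            ring
          · have h5 : ¬ k = a := fun h => hjk h.symm
            simp [h3, h4, h5]
        · by_cases h3 : b = j
          · subst h3
            by_cases h4 : k = a
            · subst h4
              simp [h1]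
              field_simp
              ring
            · have h5 : ¬ a = k := fun h => h4 h.symm
              have h6 : ¬ k = b := fun h => hjk h.symm
              simp [h1, h4, h5, h6]
          · have h1' : ¬ j = a := fun h => h1 h.symm
            have h3' : ¬ j = b := fun h => h3 h.symm
            simp [h1, h3, h1', h3', hab]
    simp_rw [key, Finset.sum_add_distrib, ← Finset.mul_sum, Finset.sum_add_distrib,
      ← Finset.sum_mul, hsum]
    simp only [constCorr, hab, if_false]
    simp
    field_simp
    ring

end Corr

namespace SyncData

variable {N : ℕ}

lemma norm_corrAt_le {σ : SyncData N} (hN : 0 < N) (hσ : σ.IsRegular) {η t : ℝ} (hη : 0 ≤ η)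
    (ht : 0 ≤ t) {M : Fin N → Fin N → ℂ} (hM : ∀ a b, ‖M a b‖ ≤ 1) (a b : Fin N) :
    ‖σ.corrAt η t M a b‖ ≤ 1 :=
  norm_decay_le hη (sub_nonneg.2 (σ.epoch_jumpsBefore_le ht))
    (norm_pairCorr_le hη (hσ.strictMono_epoch hN).monotone _ hM _ _ _)

lemma corrAt_sum {ι : Type*} (s : Finset ι) (σ : SyncData N) (η t : ℝ) (w : ι → ℂ)
    (M : ι → Fin N → Fin N → ℂ) (a b : Fin N) :
    σ.corrAt η t (fun a b => ∑ i ∈ s, w i * M i a b) a b =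
      ∑ i ∈ s, w i * σ.corrAt η t (M i) a b := by
  unfold corrAt
  rw [pairCorr_sum, decay_sum]

/-- Without ties, exactly one component has the smallest first gap, so the events `first k`
partition the space up to a null set. -/
lemma integral_eq_sum_first {μ : Measure (SyncData N)} (hN : 0 < N)
    (hreg : ∀ᵐ σ ∂μ, σ.IsRegular) {H : SyncData N → ℂ} (hH : Integrable H μ) :
    ∫ σ, H σ ∂μ = ∑ k, ∫ σ in first k, H σ ∂μ := by
  rw [← integral_iUnion_fintype measurableSet_first ?_ fun k => hH.integrableOn]
  · have : (⋃ k : Fin N, first k) =ᵐ[μ] Set.univ := by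
      rw [eventuallyEq_univ]
      filter_upwards [hreg] with σ hσ
      have : Nonempty (Fin N) := ⟨⟨0, hN⟩⟩
      obtain ⟨k, hk⟩ := Finite.exists_min fun k : Fin N => σ.1 (k, 0)
      refine Set.mem_iUnion.2 ⟨k, fun j hj => lt_of_le_of_ne (hk j) fun h => hj ?_⟩
      have h1 : σ.msgTime (k, 0) = σ.msgTime (j, 0) := by simpa [msgTime_eq] using h
      exact (congrArg Prod.fst (hσ.injective h1)).symm
    rw [setIntegral_congr_set this, setIntegral_univ]
  · intro k j hkj
    refine Set.disjoint_left.2 fun σ h1 h2 => ?_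
    exact absurd (h1 j hkj.symm) (not_lt.2 (h2 k hkj).le)

/-- The mean pair correlations at time `t`. -/
noncomputable def meanCorr (r : ℝ) (ν : Fin N → Measure (Fin N)) (η t : ℝ)
    (M : Fin N → Fin N → ℂ) (a b : Fin N) : ℂ := ∫ σ, σ.corrAt η t M a b ∂law r ν

section

variable {r : ℝ} (ν : Fin N → Measure (Fin N)) [∀ k, IsProbabilityMeasure (ν k)]

lemma integrable_corrAt (hr : 0 < r) (hN : 0 < N) {η t : ℝ} (hη : 0 ≤ η)
    (ht : 0 ≤ t) {M : Fin N → Fin N → ℂ} (hM : ∀ a b, ‖M a b‖ ≤ 1) (a b : Fin N) :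
    Integrable (fun σ : SyncData N => σ.corrAt η t M a b) (law r ν) := by
  have := isProbabilityMeasure_law ν hr
  refine Integrable.of_bound (aestronglyMeasurable_corrAt hr ν η t M a b) 1 ?_
  filter_upwards [ae_isRegular ν hr] with σ hσ
  exact norm_corrAt_le hN hσ hη ht hM a b

lemma norm_meanCorr_le (hr : 0 < r) (hN : 0 < N) {η t : ℝ} (hη : 0 ≤ η)
    (ht : 0 ≤ t) {M : Fin N → Fin N → ℂ} (hM : ∀ a b, ‖M a b‖ ≤ 1) (a b : Fin N) :
    ‖meanCorr r ν η t M a b‖ ≤ 1 := by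
  have := isProbabilityMeasure_law ν hr
  have h := norm_integral_le_of_norm_le_const (μ := law r ν) (C := 1)
    (f := fun σ : SyncData N => σ.corrAt η t M a b) (by
      filter_upwards [ae_isRegular ν hr] with σ hσ
      exact norm_corrAt_le hN hσ hη ht hM a b)
  simpa [meanCorr] using h

/-- The renewal equation for the mean pair correlations. -/
lemma meanCorr_renewal (hr : 0 < r) (hN : 2 ≤ N)
    (hν : ∀ k j, (ν k).real {j} = uniformRouting N k j) {η t : ℝ} (hη : 0 ≤ η) (ht : 0 ≤ t)
    {c : ℂ} (hc : ‖c‖ ≤ 1) {a b : Fin N} (hab : a ≠ b) {F : ℝ → ℂ}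
    (hF : F = fun s => (N * r * Real.exp (-(N * r * s))) •
      if s < t then meanCorr r ν η (t - s) (constCorr N (Real.exp (-(η * s)) * c +
        2 / (N * (N - 1)) * (1 - Real.exp (-(η * s)) * c))) a b
      else Real.exp (-(η * t)) * c) :
    IntegrableOn F (Set.Ioi 0) ∧
      meanCorr r ν η t (constCorr N c) a b = ∫ s in Set.Ioi 0, F s := by
  have := isProbabilityMeasure_law ν hr
  have hN0 : 0 < N := by omega
  have hreg := ae_isRegular ν hr
  -- The correlation at time `t`, given a first message at `s` from `k` to `j`, as a function of the
  -- data seen after it. If `s ≥ t`, only the free damping has acted.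
  set Φ : Fin N → ℝ → Fin N → SyncData N → ℂ := fun k s j σ =>
    if s < t then σ.corrAt η (t - s) (fun a b => decay η s (constCorr N c) (pairMap k j a)
      (pairMap k j b)) a b else decay η t (constCorr N c) a b with hΦdef
  have hΦm : ∀ k s j, AEStronglyMeasurable (Φ k s j) (law r ν) := fun k s j => by
    simp only [hΦdef]
    split_ifs
    · exact aestronglyMeasurable_corrAt hr ν η _ _ a b
    · exact aestronglyMeasurable_const
  have hH := integrable_corrAt ν hr hN0 hη ht (norm_constCorr_le hc) a b
  have hfirst := fun k => setIntegral_first ν hr hreg k hH (hΦm k) (fun σ hσ hk => by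
    simp only [hΦdef]
    split_ifs with h
    · rw [corrAt_of_first_lt hσ hk η h]
    · rw [corrAt_of_le_first hσ hk η (not_lt.1 h)])
  have hFsum : ∀ s ∈ Set.Ioi (0 : ℝ), ∑ k, (r * Real.exp (-(N * r * s))) •
      ∫ j, (∫ σ, Φ k s j σ ∂law r ν) ∂ν k = F s := fun s hs => by
    have hs' : (0 : ℝ) < s := hs
    rw [hF, ← Finset.smul_sum]
    simp only
    rw [show N * r * Real.exp (-(N * r * s)) = r * Real.exp (-(N * r * s)) * N by ring,
      mul_smul _ (N : ℝ)]
    congr 1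
    have hint : ∀ k, ∫ j, (∫ σ, Φ k s j σ ∂law r ν) ∂ν k =
        ∑ j, (uniformRouting N k j : ℂ) * ∫ σ, Φ k s j σ ∂law r ν := fun k => by
      rw [integral_fintype Integrable.of_finite]
      simp [hν]
    simp_rw [hint]
    by_cases hst : s < t
    · simp only [hΦdef, hst, if_true]
      have hM : ∀ p : Fin N × Fin N, ∀ a b, ‖decay η s (constCorr N c) (pairMap p.1 p.2 a)
          (pairMap p.1 p.2 b)‖ ≤ 1 := fun p a b =>
        norm_decay_le hη hs'.le (norm_constCorr_le hc _ _)
      rw [← Fintype.sum_prod_type' (f := fun k j => (uniformRouting N k j : ℂ) *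
        ∫ σ, σ.corrAt η (t - s) (fun a b => decay η s (constCorr N c) (pairMap k j a)
          (pairMap k j b)) a b ∂law r ν)]
      simp_rw [← integral_const_mul]
      rw [← integral_finsetSum _ fun p _ => (integrable_corrAt ν hr hN0 hη
        (sub_nonneg.2 hst.le) (hM p) a b).const_mul _]
      simp_rw [← corrAt_sum]
      -- The averaged matrix is `N` times one of exchangeable type. The sum over `Unit` casts this
      -- scalar multiple in the form needed for `corrAt_sum`.
      have hmat : (fun a b => ∑ p : Fin N × Fin N, (uniformRouting N p.1 p.2 : ℂ) *
          decay η s (constCorr N c) (pairMap p.1 p.2 a) (pairMap p.1 p.2 b)) =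
          fun a b => ∑ _i : Unit, (N : ℂ) * constCorr N (Real.exp (-(η * s)) * c +
            2 / (N * (N - 1)) * (1 - Real.exp (-(η * s)) * c)) a b := by
        ext a b
        rw [Fintype.sum_prod_type, decay_constCorr, sum_uniformRouting_constCorr hN]
        simp
      rw [hmat]
      simp_rw [corrAt_sum]
      simp [meanCorr, integral_const_mul]
    · simp only [hΦdef, hst, if_false, decay_constCorr, integral_const]
      simp only [constCorr, hab, if_false]
      have : ∑ k : Fin N, ∑ j, (uniformRouting N k j : ℂ) = N := by
        have : ∑ k : Fin N, ∑ j, uniformRouting N k j = N := by simp [sum_uniformRouting hN]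
        exact_mod_cast this
      simp_rw [← Finset.sum_mul, this]
      simp
  have hI : ∀ k ∈ Finset.univ, IntegrableOn (fun s : ℝ => (r * Real.exp (-(N * r * s))) •
      ∫ j, (∫ σ, Φ k s j σ ∂law r ν) ∂ν k) (Set.Ioi 0) := fun k _ => (hfirst k).1
  constructor
  · exact IntegrableOn.congr_fun (integrable_finsetSum _ hI) hFsum measurableSet_Ioi
  · rw [meanCorr, integral_eq_sum_first hN0 hreg hH, ← setIntegral_congr_fun measurableSet_Ioi hFsum,
      integral_finsetSum _ hI]
    exact Finset.sum_congr rfl fun k _ => (hfirst k).2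

end

end SyncData

/-! ### The explicit solution and its renewal equation. -/

/-- The solution of `y' = -(η + w) y + w` with `y 0 = c`. -/
noncomputable def relax (η w t : ℝ) (c : ℂ) : ℂ :=
  ((w / (η + w) : ℝ) : ℂ) + (c - ((w / (η + w) : ℝ) : ℂ)) * (Real.exp (-((η + w) * t)) : ℂ)

lemma hasDerivAt_ofReal_exp (k x : ℝ) :
    HasDerivAt (fun s : ℝ => ((Real.exp (-(k * s)) : ℝ) : ℂ)) (-k * Real.exp (-(k * x)) : ℂ) x := by
  have h : HasDerivAt (fun s : ℝ => Real.exp (-(k * s))) (Real.exp (-(k * x)) * -(k * 1)) x :=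
    (((hasDerivAt_id x).const_mul k).neg).exp
  convert! h.ofReal_comp using 1
  push_cast
  ring

/-- On `(0, t)` the integrand has the primitive `s ↦ -exp(-L s) * relax η w (t - s) (exp(-η s) c)`:
the jump term produces its derivative because `L p = w`. The boundary term at `s = t` cancels the
contribution of `(t, ∞)`, leaving the value at `s = 0`. -/
lemma relax_renewal {η w L p t : ℝ} (hη : 0 ≤ η) (hw : 0 < w) (hL : 0 < L) (hp : L * p = w)
    (ht : 0 ≤ t) (c : ℂ) {F : ℝ → ℂ}
    (hF : F = fun s => (L * Real.exp (-(L * s))) •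
      if s < t then relax η w (t - s) (Real.exp (-(η * s)) * c +
        p * (1 - Real.exp (-(η * s)) * c))
      else Real.exp (-(η * t)) * c) :
    IntegrableOn F (Set.Ioi 0) ∧ relax η w t c = ∫ s in Set.Ioi 0, F s := by
  set F₁ : ℝ → ℂ := fun s => (L * Real.exp (-(L * s))) •
    relax η w (t - s) (Real.exp (-(η * s)) * c + p * (1 - Real.exp (-(η * s)) * c)) with hF₁
  set F₂ : ℝ → ℂ := fun s => ((Real.exp (-L * s) : ℝ) : ℂ) * (L * Real.exp (-(η * t)) * c) with hF₂
  have hcont : Continuous F₁ := by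
    simp only [hF₁, relax]
    fun_prop
  have h1 : F =ᵐ[volume.restrict (Set.Ioc 0 t)] F₁ := by
    have h0 : ∀ᵐ s : ℝ, s ≠ t := by simp [ae_iff]
    filter_upwards [ae_restrict_of_ae h0, ae_restrict_mem measurableSet_Ioc] with s hs hs'
    simp [hF, hF₁, lt_of_le_of_ne hs'.2 hs]
  have h2 : ∀ s ∈ Set.Ioi t, F₂ s = F s := fun s hs => by
    have : ¬ s < t := not_lt.2 (le_of_lt hs)
    simp only [hF, hF₂, this, if_false, Complex.real_smul]
    push_cast
    ring_nf
  have hi1 : IntegrableOn F₁ (Set.Ioc 0 t) := (hcont.integrableOn_Icc).mono_set Set.Ioc_subset_Icc_self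
  have hi2 : IntegrableOn F₂ (Set.Ioi t) :=
    ((integrableOn_exp_mul_Ioi (neg_neg_of_pos hL) t).ofReal).mul_const _
  have hi1' : IntegrableOn F (Set.Ioc 0 t) := hi1.congr h1.symm
  have hi2' : IntegrableOn F (Set.Ioi t) := hi2.congr_fun h2 measurableSet_Ioi
  rw [← Set.Ioc_union_Ioi_eq_Ioi ht]
  refine ⟨hi1'.union hi2', ?_⟩
  rw [setIntegral_union (Set.Ioc_disjoint_Ioi le_rfl) measurableSet_Ioi hi1' hi2',
    integral_congr_ae h1, ← setIntegral_congr_fun measurableSet_Ioi h2]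
  have hv2 : ∫ s in Set.Ioi t, F₂ s = Real.exp (-(L * t)) * (Real.exp (-(η * t)) * c) := by
    simp only [hF₂]
    rw [integral_mul_const, integral_complex_ofReal, integral_exp_mul_Ioi (neg_neg_of_pos hL) t]
    have : (L : ℂ) ≠ 0 := by exact_mod_cast hL.ne'
    push_cast
    field_simp
  -- The equilibrium value, characterized by `(η + w) l = w`.
  set l : ℂ := ((w / (η + w) : ℝ) : ℂ) with hl
  have hlq : ((η + w : ℝ) : ℂ) * l = w := by
    rw [hl, ← Complex.ofReal_mul, mul_div_cancel₀ _ (by positivity)]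
  have hpc : (L : ℂ) * p = w := by exact_mod_cast hp
  have hd : ∀ s, HasDerivAt (fun s : ℝ => -((Real.exp (-(L * s)) : ℝ) : ℂ) *
      (l + (((Real.exp (-(η * s)) : ℝ) : ℂ) * c - l) *
        ((Real.exp (-((η + w) * (t - s))) : ℝ) : ℂ))) (F₁ s) s := fun s => by
    have d1 := hasDerivAt_ofReal_exp L s
    have d2 := hasDerivAt_ofReal_exp η s
    have d3 : HasDerivAt (fun s : ℝ => ((Real.exp (-((η + w) * (t - s))) : ℝ) : ℂ))
        (((η + w : ℝ) : ℂ) * Real.exp (-((η + w) * (t - s)))) s := by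
      have := (hasDerivAt_ofReal_exp (η + w) (t - s)).scomp s ((hasDerivAt_id s).const_sub t)
      convert! this using 1
      simp
      ring
    convert! d1.neg.mul (((((d2.mul_const c).sub_const l).mul d3)).const_add l) using 1
    simp only [hF₁, relax, ← hl, Complex.real_smul, Pi.neg_apply, Pi.mul_apply]
    push_cast at hlq ⊢
    linear_combination (-(Complex.exp (-(L * s)) * Complex.exp (-((η + w) * (t - s))))) * hlq +
      (Complex.exp (-(L * s)) * Complex.exp (-((η + w) * (t - s))) *
        (1 - Complex.exp (-(η * s)) * c)) * hpc
  have hv1 : ∫ s in Set.Ioc 0 t, F₁ s = relax η w t c -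
      Real.exp (-(L * t)) * (Real.exp (-(η * t)) * c) := by
    rw [← intervalIntegral.integral_of_le ht,
      intervalIntegral.integral_eq_sub_of_hasDerivAt (fun s _ => hd s)
        (hcont.intervalIntegrable _ _)]
    simp [relax, ← hl]
    ring
  rw [hv1, hv2]
  ring

lemma norm_relax_le {η w t : ℝ} (hη : 0 ≤ η) (hw : 0 < w) (ht : 0 ≤ t) {c : ℂ} (hc : ‖c‖ ≤ 1) :
    ‖relax η w t c‖ ≤ 3 := by
  have hl : ‖((w / (η + w) : ℝ) : ℂ)‖ ≤ 1 := by
    rw [Complex.norm_real, Real.norm_of_nonneg (by positivity), div_le_one (by positivity)]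
    linarith
  have he : ‖((Real.exp (-((η + w) * t)) : ℝ) : ℂ)‖ ≤ 1 := by
    rw [Complex.norm_real, Real.norm_of_nonneg (Real.exp_pos _).le, Real.exp_le_one_iff]
    have : 0 ≤ (η + w) * t := by positivity
    linarith
  calc ‖relax η w t c‖ ≤ 1 + (1 + 1) * 1 := by
        unfold relax
        refine (norm_add_le _ _).trans (add_le_add hl ?_)
        rw [norm_mul]
        exact mul_le_mul ((norm_sub_le _ _).trans (add_le_add hc hl)) he (norm_nonneg _)
          (by norm_num)
    _ = 3 := by norm_num

/-! ### Uniqueness for the renewal equation. -/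

namespace SyncData

variable {N : ℕ} {r : ℝ} (ν : Fin N → Measure (Fin N)) [∀ k, IsProbabilityMeasure (ν k)]

/-- The mean pair correlations of an exchangeable configuration relax exponentially. -/
theorem meanCorr_eq_relax (hr : 0 < r) (hN : 2 ≤ N)
    (hν : ∀ k j, (ν k).real {j} = uniformRouting N k j) {η t : ℝ} (hη : 0 ≤ η) (ht : 0 ≤ t)
    {c : ℂ} (hc : ‖c‖ ≤ 1) {a b : Fin N} (hab : a ≠ b) :
    meanCorr r ν η t (constCorr N c) a b = relax η (2 * r / (N - 1)) t c := by
  have hN0 : 0 < N := by omega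
  have h2 : (2 : ℝ) ≤ N := by exact_mod_cast hN
  have hN1 : (0 : ℝ) < N - 1 := by linarith
  set w : ℝ := 2 * r / (N - 1) with hw
  set L : ℝ := N * r with hL
  set p : ℝ := 2 / (N * (N - 1)) with hp
  have hw0 : 0 < w := by positivity
  have hL0 : 0 < L := by positivity
  have hLp : L * p = w := by
    rw [hL, hp, hw]
    field_simp
  have hp0 : 0 ≤ p := by positivity
  have hp1 : p ≤ 1 := by
    rw [hp, div_le_one (by positivity)]
    nlinarith
  -- The probability that an exponential first message of rate `L` arrives before `t`; it serves as
  -- the contraction factor.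
  set θ : ℝ := 1 - Real.exp (-(L * t)) with hθ
  have hθ0 : 0 ≤ θ := by
    have : Real.exp (-(L * t)) ≤ 1 := Real.exp_le_one_iff.2 (by have := mul_nonneg hL0.le ht; linarith)
    linarith
  have hθ1 : θ < 1 := by have := Real.exp_pos (-(L * t)); linarith
  -- The new constant is the convex combination of `exp(-η s) c` and `1` with weight `p` on `1`, so
  -- it stays in the unit disc and the induction hypothesis applies to it.
  have hy : ∀ s, 0 ≤ s → ∀ c : ℂ, ‖c‖ ≤ 1 →
      ‖(Real.exp (-(η * s)) : ℂ) * c + p * (1 - Real.exp (-(η * s)) * c)‖ ≤ 1 := by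
    intro s hs c hc
    have he : ‖(Real.exp (-(η * s)) : ℂ) * c‖ ≤ 1 := by
      rw [norm_mul, Complex.norm_real, Real.norm_of_nonneg (Real.exp_pos _).le]
      refine mul_le_one₀ (Real.exp_le_one_iff.2 ?_) (norm_nonneg _) hc
      have := mul_nonneg hη hs
      linarith
    have : (Real.exp (-(η * s)) : ℂ) * c + p * (1 - Real.exp (-(η * s)) * c) =
        ((1 - p : ℝ) : ℂ) * (Real.exp (-(η * s)) * c) + (p : ℝ) := by
      push_cast; ring
    rw [this]
    refine (norm_add_le _ _).trans ?_
    rw [norm_mul, Complex.norm_real, Complex.norm_real, Real.norm_of_nonneg (by linarith),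
      Real.norm_of_nonneg hp0]
    nlinarith
  -- The bound must be uniform over `u ≤ t` and `c` in the unit disc, since the renewal equation
  -- changes both. The initial bound `4` is `1 + 3`, from `norm_meanCorr_le` and `norm_relax_le`.
  have key : ∀ n : ℕ, ∀ u, 0 ≤ u → u ≤ t → ∀ c : ℂ, ‖c‖ ≤ 1 →
      ‖meanCorr r ν η u (constCorr N c) a b - relax η w u c‖ ≤ θ ^ n * 4 := by
    intro n
    induction n with
    | zero =>
      intro u hu _ c hc
      have h1 := norm_meanCorr_le ν hr hN0 hη hu (norm_constCorr_le hc) a b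
      have h2 := norm_relax_le hη hw0 hu hc
      have := norm_sub_le (meanCorr r ν η u (constCorr N c) a b) (relax η w u c)
      linarith
    | succ n ih =>
      intro u hu hut c hc
      obtain ⟨i1, e1⟩ := meanCorr_renewal ν hr hN hν hη hu hc hab rfl
      obtain ⟨i2, e2⟩ := relax_renewal hη hw0 hL0 hLp hu c rfl
      rw [e1, e2, ← integral_sub i1 i2]
      have hB : ∫ s in Set.Ioi (0 : ℝ), (Set.Ioc 0 u).indicator
          (fun s => L * Real.exp (-(L * s)) * (θ ^ n * 4)) s =
          (1 - Real.exp (-(L * u))) * (θ ^ n * 4) := by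
        rw [setIntegral_indicator measurableSet_Ioc,
          Set.inter_eq_self_of_subset_right Set.Ioc_subset_Ioi_self,
          ← intervalIntegral.integral_of_le hu, intervalIntegral.integral_mul_const,
          intervalIntegral.integral_eq_sub_of_hasDerivAt (f := fun s => -Real.exp (-(L * s)))]
        · rw [mul_zero, neg_zero, Real.exp_zero]
          ring
        · intro s _
          have := ((((hasDerivAt_id s).const_mul L).neg).exp).neg
          convert! this using 1
          simp
          ring
        · exact Continuous.intervalIntegrable (by fun_prop) _ _
      have hle : ‖∫ s in Set.Ioi (0 : ℝ), ((L * Real.exp (-(L * s))) •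
          (if s < u then meanCorr r ν η (u - s) (constCorr N (Real.exp (-(η * s)) * c +
            2 / (N * (N - 1)) * (1 - Real.exp (-(η * s)) * c))) a b
          else Real.exp (-(η * u)) * c) - (L * Real.exp (-(L * s))) •
          (if s < u then relax η w (u - s) (Real.exp (-(η * s)) * c +
            p * (1 - Real.exp (-(η * s)) * c)) else Real.exp (-(η * u)) * c))‖ ≤
          ∫ s in Set.Ioi (0 : ℝ), (Set.Ioc 0 u).indicator
          (fun s => L * Real.exp (-(L * s)) * (θ ^ n * 4)) s := by
        refine norm_integral_le_of_norm_le ?_ ?_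
        · refine Integrable.integrableOn ?_
          rw [integrable_indicator_iff measurableSet_Ioc]
          exact (Continuous.integrableOn_Icc (by fun_prop)).mono_set Set.Ioc_subset_Icc_self
        · filter_upwards [ae_restrict_mem measurableSet_Ioi] with s hs
          have hs' : (0 : ℝ) < s := hs
          rw [← smul_sub]
          set G : ℝ → ℝ := fun s => L * Real.exp (-(L * s)) * (θ ^ n * 4) with hG
          by_cases hsu : s < u
          · rw [Set.indicator_of_mem (show s ∈ Set.Ioc 0 u from ⟨hs', hsu.le⟩), norm_smul, Real.norm_of_nonneg (by positivity)]
            simp only [hsu, if_true]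
            have hpc : (2 : ℂ) / (N * (N - 1)) = (p : ℂ) := by rw [hp]; push_cast; rfl
            rw [hpc]
            exact mul_le_mul_of_nonneg_left
              (ih (u - s) (by linarith) (by linarith) _ (hy s hs'.le c hc)) (by positivity)
          -- Without a message before `u` the two integrands coincide, so only `(0, u]` contributes
          -- to the error.
          · simp only [hsu, if_false, sub_self, smul_zero, norm_zero]
            have hG0 : 0 ≤ G s := by positivity
            exact Set.indicator_apply_nonneg fun _ => hG0
      refine hle.trans ?_
      rw [hB, pow_succ', mul_assoc θ]
      have h0 : 0 ≤ θ ^ n * 4 := by positivity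
      refine mul_le_mul_of_nonneg_right ?_ h0
      rw [hθ]
      have : Real.exp (-(L * t)) ≤ Real.exp (-(L * u)) :=
        Real.exp_le_exp.2 (by have := mul_le_mul_of_nonneg_left hut hL0.le; linarith)
      linarith
  have hlim : Tendsto (fun n : ℕ => θ ^ n * 4) atTop (𝓝 0) := by
    simpa using (tendsto_pow_atTop_nhds_zero_of_lt_one hθ0 hθ1).mul_const 4
  have := ge_of_tendsto' hlim fun n => key n t ht le_rfl c hc
  exact sub_eq_zero.1 (norm_le_zero_iff.1 this)

end SyncData

/-! ### Configurations with prescribed synchronization -/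

section Config

variable {N d : ℕ}

/-- The configuration after `q` jumps by the maps `f 0, …, f (q - 1)`, if the initial configuration
is `x` and `y i` are the values of the free dynamics at the `i`-th epoch. -/
def config {E : Type*} [AddGroup E] (x : Fin N → E) (y : ℕ → Fin N → E) (f : ℕ → Fin N → Fin N) :
    ℕ → Fin N → E
  | 0 => x
  | q + 1 => fun a => config x y f q (f q a) + (y (q + 1) (f q a) - y q (f q a))

lemma config_congr {E : Type*} [AddGroup E] (x : Fin N → E) {y y' : ℕ → Fin N → E}
    {f f' : ℕ → Fin N → Fin N} {q : ℕ} (hy : ∀ i ≤ q, y i = y' i) (hf : ∀ i < q, f i = f' i) :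
    config x y f q = config x y' f' q := by
  induction q with
  | zero => rfl
  | succ q ih =>
    simp only [config]
    rw [ih (fun i hi => hy i (by omega)) (fun i hi => hf i (by omega)), hy _ le_rfl,
      hy q (by omega), hf q (by omega)]

lemma pairCorr_congr (η : ℝ) (M : Fin N → Fin N → ℂ) {τ τ' : ℕ → ℝ}
    {f f' : ℕ → Fin N → Fin N} {q : ℕ} (hτ : ∀ i ≤ q, τ i = τ' i) (hf : ∀ i < q, f i = f' i) :
    pairCorr η τ f M q = pairCorr η τ' f' M q := by
  induction q with
  | zero => rfl
  | succ q ih =>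
    simp only [pairCorr]
    rw [ih (fun i hi => hτ i (by omega)) (fun i hi => hf i (by omega)), hτ _ le_rfl,
      hτ q (by omega), hf q (by omega)]

lemma tendsto_config {E ι : Type*} [AddGroup E] [TopologicalSpace E] [IsTopologicalAddGroup E]
    {l : Filter ι} (x : Fin N → E) {y : ℕ → Fin N → E} {y' : ι → ℕ → Fin N → E}
    (f : ℕ → Fin N → Fin N) (hy : ∀ q a, Tendsto (fun n => y' n q a) l (𝓝 (y q a))) (q : ℕ)
    (a : Fin N) : Tendsto (fun n => config x (y' n) f q a) l (𝓝 (config x y f q a)) := by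
  induction q generalizing a with
  | zero => exact tendsto_const_nhds
  | succ q ih => exact (ih _).add ((hy _ _).sub (hy _ _))

lemma tendsto_pairCorr {ι : Type*} {l : Filter ι} (η : ℝ) (M : Fin N → Fin N → ℂ) {τ : ℕ → ℝ}
    {τ' : ι → ℕ → ℝ} (f : ℕ → Fin N → Fin N)
    (hτ : ∀ q, Tendsto (fun n => τ' n q) l (𝓝 (τ q))) (q : ℕ) (a b : Fin N) :
    Tendsto (fun n => pairCorr η (τ' n) f M q a b) l (𝓝 (pairCorr η τ f M q a b)) := by
  induction q generalizing a b with
  | zero => exact tendsto_const_nhds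
  | succ q ih =>
    simp only [pairCorr, decay]
    refine Tendsto.mul ?_ (ih _ _)
    split_ifs
    · exact tendsto_const_nhds
    · have hc : Continuous fun s : ℝ => ((Real.exp (-(η * s)) : ℝ) : ℂ) := by fun_prop
      exact (hc.tendsto _).comp ((hτ _).sub (hτ _))

lemma measurable_config {E α : Type*} [AddGroup E] [MeasurableSpace E] [MeasurableAdd₂ E]
    [MeasurableSub₂ E] [MeasurableSpace α] {x : α → Fin N → E} (hx : Measurable x)
    {y : ℕ → Fin N → α → E} (hy : ∀ q a, Measurable (y q a)) {f : ℕ → α → Fin N → Fin N}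
    (hf : ∀ q, Measurable (f q)) (q : ℕ) (a : Fin N) :
    Measurable fun ω => config (x ω) (fun q a => y q a ω) (fun q => f q ω) q a := by
  induction q generalizing a with
  | zero => exact (measurable_pi_apply a).comp hx
  | succ q ih =>
    exact measurable_index (fun b => (ih b).add ((hy (q + 1) b).sub (hy q b)))
      ((measurable_pi_apply a).comp (hf q))

end Config

/-! ### The free dynamics -/

section Free

variable {Ω : Type*} [MeasurableSpace Ω] {P : Measure Ω} {N d : ℕ}
  {S : Ingredients Ω N d} {ψ : EuclideanSpace ℝ (Fin d) → ℂ}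

/-- The characteristic function at `-u` is the conjugate of that at `u`, so the product is the
squared modulus `exp(2 t Re ψ(u))`. -/
lemma IsLevyWithExponent.exp_mul_exp_neg {X : ℝ≥0 → Ω → EuclideanSpace ℝ (Fin d)}
    (h : IsLevyWithExponent P X ψ) (t : ℝ≥0) (u : EuclideanSpace ℝ (Fin d)) :
    Complex.exp (t * ψ u) * Complex.exp (t * ψ (-u)) = (Real.exp (-(eta ψ u * t)) : ℂ) := by
  rw [← h.charFun_eq t (-u), charFun_neg, h.charFun_eq, Complex.mul_conj, Complex.normSq_eq_norm_sq,
    Complex.norm_exp, ← Real.exp_nat_mul]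
  congr 2
  simp [eta]
  ring

lemma IsLevyWithExponent.integral_exp_increment {X : ℝ≥0 → Ω → EuclideanSpace ℝ (Fin d)}
    (h : IsLevyWithExponent P X ψ) {s t : ℝ≥0} (hst : s ≤ t) (c : ℝ)
    (u : EuclideanSpace ℝ (Fin d)) :
    ∫ ω, Complex.exp (Complex.I * ((c * inner ℝ u (X t ω - X s ω) : ℝ) : ℂ)) ∂P =
      Complex.exp (((t - s : ℝ≥0) : ℂ) * ψ (c • u)) := by
  have h1 := (h.stationary_increments s (t - s)).map_eq
  rw [add_tsub_cancel_of_le hst] at h1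
  rw [← h.charFun_eq, ← h1, charFun_apply, integral_map
    (((h.measurable t).fun_sub (h.measurable s)).aemeasurable) (by fun_prop)]
  refine integral_congr_ae (ae_of_all _ fun ω => ?_)
  simp only
  rw [inner_smul_right, real_inner_comm, mul_comm]

variable {F : Fin N → Measure ℝ} {R : Matrix (Fin N) (Fin N) ℝ}

/-- Independence of the components factors the expectation over `j`; independence of the increments
of each component then factors it over `i`. The free coefficients `c` are needed for the induction
in `integral_exp_config_increments`. -/
lemma integral_exp_increments (hS : IsGG P S (fun _ => ψ) F R) {τ : ℕ → ℝ≥0} (hτ : Monotone τ)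
    (c : ℕ → Fin N → ℝ) (n : ℕ) (u : EuclideanSpace ℝ (Fin d)) :
    ∫ ω, Complex.exp (Complex.I * ((∑ i ∈ Finset.range n, ∑ j, c i j *
      inner ℝ u (S.free j (τ (i + 1)) ω - S.free j (τ i) ω) : ℝ) : ℂ)) ∂P =
      ∏ i ∈ Finset.range n, ∏ j, Complex.exp (((τ (i + 1) - τ i : ℝ≥0) : ℂ) * ψ (c i j • u)) := by
  set g : Fin N → (ℝ≥0 → EuclideanSpace ℝ (Fin d)) → ℂ := fun j x =>
    Complex.exp (Complex.I * ((∑ i ∈ Finset.range n, c i j *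
      inner ℝ u (x (τ (i + 1)) - x (τ i)) : ℝ) : ℂ)) with hg
  have hgm : ∀ j, Measurable (g j) := fun j => by
    simp only [hg]
    fun_prop
  have hpm : ∀ j, Measurable fun ω => fun t => S.free j t ω := fun j =>
    measurable_pi_lambda _ fun t => (hS.levy_free j).measurable t
  have h1 := hS.indep_free.integral_fun_prod_comp (f := g) (fun j => (hpm j).aemeasurable)
    (fun j => (hgm j).aestronglyMeasurable)
  have h2 : ∀ ω, Complex.exp (Complex.I * ((∑ i ∈ Finset.range n, ∑ j, c i j *
      inner ℝ u (S.free j (τ (i + 1)) ω - S.free j (τ i) ω) : ℝ) : ℂ)) =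
      ∏ j, g j (fun t => S.free j t ω) := fun ω => by
    simp only [hg]
    rw [← Complex.exp_sum, ← Finset.mul_sum, Finset.sum_comm]
    push_cast
    rfl
  simp_rw [h2]
  rw [h1, Finset.prod_comm]
  refine Finset.prod_congr rfl fun j _ => ?_
  have hL := hS.levy_free j
  have h3 := ((hL.indep_increments.nat hτ).precomp (g := fun i : Fin n => (i : ℕ))
    Fin.val_injective).integral_fun_prod_comp
    (f := fun (i : Fin n) (x : EuclideanSpace ℝ (Fin d)) =>
      Complex.exp (Complex.I * ((c i j * inner ℝ u x : ℝ) : ℂ)))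
    (fun i => ((hL.measurable _).sub (hL.measurable _)).aemeasurable)
    (fun i => by fun_prop)
  have h4 : ∀ ω, g j (fun t => S.free j t ω) = ∏ i : Fin n,
      Complex.exp (Complex.I * ((c i j * inner ℝ u
        (S.free j (τ (i + 1)) ω - S.free j (τ i) ω) : ℝ) : ℂ)) := fun ω => by
    rw [← Complex.exp_sum, ← Finset.mul_sum]
    simp only [hg, Finset.sum_range]
    push_cast
    rfl
  simp_rw [h4]
  rw [h3, Finset.prod_range]
  exact Finset.prod_congr rfl fun i _ => hL.integral_exp_increment (hτ (Nat.le_succ _)) _ _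

variable [IsProbabilityMeasure P]

lemma IsLevyWithExponent.exp_zero {X : ℝ≥0 → Ω → EuclideanSpace ℝ (Fin d)}
    (h : IsLevyWithExponent P X ψ) (t : ℝ≥0) : Complex.exp (t * ψ 0) = 1 := by
  have : IsProbabilityMeasure (P.map (X t)) :=
    Measure.isProbabilityMeasure_map (h.measurable t).aemeasurable
  rw [← h.charFun_eq]
  simp

lemma IsLevyWithExponent.eta_nonneg {X : ℝ≥0 → Ω → EuclideanSpace ℝ (Fin d)}
    (h : IsLevyWithExponent P X ψ) (u : EuclideanSpace ℝ (Fin d)) : 0 ≤ eta ψ u := by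
  have : IsProbabilityMeasure (P.map (X 1)) :=
    Measure.isProbabilityMeasure_map (h.measurable 1).aemeasurable
  have h1 := norm_charFun_le_one (μ := P.map (X 1)) u
  rw [h.charFun_eq, Complex.norm_exp, Real.exp_le_one_iff] at h1
  simp at h1
  unfold eta
  linarith

/-- The correlations of the initial configuration. -/
noncomputable def initCorr (P : Measure Ω) (S : Ingredients Ω N d) (u : EuclideanSpace ℝ (Fin d))
    (a b : Fin N) : ℂ :=
  ∫ ω, Complex.exp (Complex.I * (inner ℝ u (S.init ω a - S.init ω b) : ℝ)) ∂P

/-- The coefficients `+1` at `a` and `-1` at `b` cancel if `a = b`. Otherwise they yield `ψ(u)` and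
`ψ(-u)`, while the remaining components contribute `exp(t ψ(0)) = 1`. -/
lemma prod_exp_pair (hS : IsGG P S (fun _ => ψ) F R) (t : ℝ≥0) (u : EuclideanSpace ℝ (Fin d))
    (a b : Fin N) :
    ∏ j, Complex.exp (t * ψ (((if j = a then 1 else 0) - (if j = b then 1 else 0) : ℝ) • u)) =
      if a = b then 1 else (Real.exp (-(eta ψ u * t)) : ℂ) := by
  have hL := hS.levy_free a
  split_ifs with hab
  · subst hab
    simp [hL.exp_zero]
  · rw [← hL.exp_mul_exp_neg t u, Finset.prod_eq_mul a b hab]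
    · simp [hab, Ne.symm hab]
    · rintro j - ⟨h1, h2⟩
      simp [h1, h2, hL.exp_zero]
    · simp
    · simp

/-- Joint characteristic function of a difference after `q` jumps and of later increments. -/
lemma integral_exp_config_increments (hS : IsGG P S (fun _ => ψ) F R) {τ : ℕ → ℝ≥0}
    (hτ : Monotone τ) (f : ℕ → Fin N → Fin N) (u : EuclideanSpace ℝ (Fin d)) (n q : ℕ)
    (hq : q ≤ n) (c : ℕ → Fin N → ℝ) (a b : Fin N) :
    ∫ ω, Complex.exp (Complex.I * ((inner ℝ u
        (config (S.init ω) (fun i j => S.free j (τ i) ω) f q a -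
          config (S.init ω) (fun i j => S.free j (τ i) ω) f q b) +
      ∑ i ∈ Finset.Ico q n, ∑ j, c i j *
        inner ℝ u (S.free j (τ (i + 1)) ω - S.free j (τ i) ω) : ℝ) : ℂ)) ∂P =
      pairCorr (eta ψ u) (fun i => (τ i : ℝ)) f (initCorr P S u) q a b *
        ∏ i ∈ Finset.Ico q n, ∏ j,
          Complex.exp (((τ (i + 1) - τ i : ℝ≥0) : ℂ) * ψ (c i j • u)) := by
  induction q generalizing c a b with
  | zero =>
    rw [← Finset.range_eq_Ico, ← integral_exp_increments hS hτ]
    have hind : IndepFun S.init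
        (fun ω => (fun j t => S.free j t ω : Fin N → ℝ≥0 → EuclideanSpace ℝ (Fin d))) P :=
      hS.indep_init.comp measurable_id measurable_fst
    have hpm : Measurable
        fun ω => (fun j t => S.free j t ω : Fin N → ℝ≥0 → EuclideanSpace ℝ (Fin d)) :=
      measurable_pi_lambda _ fun j => measurable_pi_lambda _ fun t => (hS.levy_free j).measurable t
    have h := hind.integral_fun_comp_mul_comp
      (f := fun x : Fin N → EuclideanSpace ℝ (Fin d) =>
        Complex.exp (Complex.I * ((inner ℝ u (x a - x b) : ℝ) : ℂ)))
      (g := fun x : Fin N → ℝ≥0 → EuclideanSpace ℝ (Fin d) =>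
        Complex.exp (Complex.I * ((∑ i ∈ Finset.range n, ∑ j, c i j *
          inner ℝ u (x j (τ (i + 1)) - x j (τ i)) : ℝ) : ℂ)))
      hS.measurable_init.aemeasurable hpm.aemeasurable (by fun_prop) (by fun_prop)
    simp only [pairCorr, initCorr, config]
    rw [← h]
    refine integral_congr_ae (ae_of_all _ fun ω => ?_)
    simp only
    rw [← Complex.exp_add]
    push_cast
    ring_nf
  | succ q ih =>
    -- Undoing the last jump expresses the difference through components `f q a` and `f q b` before
    -- it plus their increment number `q`. That increment is absorbed into the coefficients, which
    -- is why the statement carries arbitrary later increments.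
    set c' : ℕ → Fin N → ℝ := fun i j => if i = q then
      (if j = f q a then 1 else 0) - (if j = f q b then 1 else 0) else c i j with hc'
    have h := ih (by omega) c' (f q a) (f q b)
    have hq' : q < n := by omega
    rw [Finset.prod_eq_prod_Ico_succ_bot hq'] at h
    have hc1 : ∀ j, c' q j = (if j = f q a then 1 else 0) - (if j = f q b then 1 else 0) :=
      fun j => by simp [hc']
    have hc2 : ∀ i ∈ Finset.Ico (q + 1) n, c' i = c i := fun i hi => by
      have : i ≠ q := by have := (Finset.mem_Ico.1 hi).1; omega
      simp [hc', this]
    rw [Finset.prod_congr (g := fun i => ∏ j, Complex.exp (((τ (i + 1) - τ i : ℝ≥0) : ℂ) *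
      ψ (c i j • u))) rfl (fun i hi => by rw [hc2 i hi])] at h
    simp_rw [hc1] at h
    rw [prod_exp_pair hS, ← mul_assoc] at h
    have hsub : ((τ (q + 1) - τ q : ℝ≥0) : ℝ) = τ (q + 1) - τ q :=
      NNReal.coe_sub (hτ (Nat.le_succ q))
    have hR : pairCorr (eta ψ u) (fun i => (τ i : ℝ)) f (initCorr P S u) (q + 1) a b =
        pairCorr (eta ψ u) (fun i => (τ i : ℝ)) f (initCorr P S u) q (f q a) (f q b) *
        (if f q a = f q b then 1 else
          (Real.exp (-(eta ψ u * ((τ (q + 1) - τ q : ℝ≥0) : ℝ))) : ℂ)) := by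
      rw [hsub]
      simp only [pairCorr, decay]
      ring
    rw [hR, ← h]
    refine integral_congr_ae (ae_of_all _ fun ω => ?_)
    simp only
    congr 3
    rw [Finset.sum_eq_sum_Ico_succ_bot hq']
    have h3 : ∑ j, c' q j * inner ℝ u (S.free j (τ (q + 1)) ω - S.free j (τ q) ω) =
        inner ℝ u (S.free (f q a) (τ (q + 1)) ω - S.free (f q a) (τ q) ω) -
          inner ℝ u (S.free (f q b) (τ (q + 1)) ω - S.free (f q b) (τ q) ω) := by
      simp [hc1, sub_mul]
    have h4 : ∑ i ∈ Finset.Ico (q + 1) n, ∑ j, c' i j *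
          inner ℝ u (S.free j (τ (i + 1)) ω - S.free j (τ i) ω) =
        ∑ i ∈ Finset.Ico (q + 1) n, ∑ j, c i j *
          inner ℝ u (S.free j (τ (i + 1)) ω - S.free j (τ i) ω) :=
      Finset.sum_congr rfl fun i hi => by rw [hc2 i hi]
    rw [h3, h4]
    simp only [config, inner_sub_right, inner_add_right]
    ring

/-- Characteristic function of a difference of components for deterministic synchronization. -/
lemma integral_exp_config (hS : IsGG P S (fun _ => ψ) F R) {τ : ℕ → ℝ≥0}
    (hτ : Monotone τ) (f : ℕ → Fin N → Fin N) (u : EuclideanSpace ℝ (Fin d)) (q : ℕ)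
    (a b : Fin N) :
    ∫ ω, Complex.exp (Complex.I * ((inner ℝ u
        (config (S.init ω) (fun i j => S.free j (τ i) ω) f q a -
          config (S.init ω) (fun i j => S.free j (τ i) ω) f q b) : ℝ) : ℂ)) ∂P =
      pairCorr (eta ψ u) (fun i => (τ i : ℝ)) f (initCorr P S u) q a b := by
  simpa using integral_exp_config_increments hS hτ f u q q le_rfl 0 a b

end Free

/-! ### The synchronization system -/

section Discretize

/-- Approximation of `s` from above by a multiple of `1 / (n + 1)`. -/
noncomputable def roundUp (n : ℕ) (s : ℝ≥0) : ℝ≥0 := (⌈s * (n + 1)⌉₊ : ℝ≥0) / (n + 1)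

lemma roundUp_mono (n : ℕ) : Monotone (roundUp n) := fun s t h => by
  unfold roundUp
  gcongr

lemma le_roundUp (n : ℕ) (s : ℝ≥0) : s ≤ roundUp n s := by
  rw [roundUp, le_div_iff₀ (by positivity)]
  exact Nat.le_ceil _

/-- Convergence from the right is the mode that right-continuous trajectories can use. -/
lemma tendsto_roundUp (s : ℝ≥0) :
    Tendsto (fun n => roundUp n s) atTop (𝓝[Set.Ici s] s) := by
  refine tendsto_nhdsWithin_iff.2 ⟨?_, Eventually.of_forall fun n => le_roundUp n s⟩
  have h : Tendsto (fun n : ℕ => s + 1 / ((n : ℝ≥0) + 1)) atTop (𝓝 (s + 0)) :=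
    tendsto_const_nhds.add tendsto_one_div_add_atTop_nhds_zero_nat
  rw [add_zero] at h
  refine tendsto_of_tendsto_of_tendsto_of_le_of_le tendsto_const_nhds h
    (fun n => le_roundUp n s) fun n => ?_
  simp only
  rw [roundUp, div_le_iff₀ (by positivity), add_mul, one_div, inv_mul_cancel₀ (by positivity)]
  exact (Nat.ceil_lt_add_one (by positivity)).le

end Discretize

namespace SyncData

variable {N : ℕ}

/-- The epochs before `t`, followed by `t`. -/
noncomputable def stoppedEpoch (t : ℝ≥0) (q : ℕ) (σ : SyncData N) : ℝ≥0 :=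
  if q ≤ σ.jumpsBefore t then (σ.epoch q).toNNReal else t

/-- The synchronization maps that act before `t`. -/
noncomputable def stoppedJump (t : ℝ≥0) (q : ℕ) (σ : SyncData N) : Fin N → Fin N :=
  if q < σ.jumpsBefore t then jump q σ else id

lemma measurable_stoppedEpoch (t : ℝ≥0) (q : ℕ) : Measurable (stoppedEpoch (N := N) t q) :=
  Measurable.ite (measurableSet_le measurable_const (measurable_jumpsBefore _))
    (measurable_epoch q).real_toNNReal measurable_const

lemma measurable_stoppedJump (t : ℝ≥0) (q : ℕ) : Measurable (stoppedJump (N := N) t q) :=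
  Measurable.ite (measurableSet_lt measurable_const (measurable_jumpsBefore _))
    (measurable_jump q) measurable_const

lemma IsRegular.monotone_stoppedEpoch {σ : SyncData N} (hN : 0 < N) (hσ : σ.IsRegular)
    (t : ℝ≥0) : Monotone fun q => stoppedEpoch t q σ := by
  refine monotone_nat_of_le_succ fun q => ?_
  unfold stoppedEpoch
  have hJ := σ.epoch_jumpsBefore_le t.2
  split_ifs with h1 h2 h2
  · exact Real.toNNReal_le_toNNReal ((hσ.strictMono_epoch hN).monotone (Nat.le_succ q))
  · exact Real.toNNReal_le_iff_le_coe.2 (((hσ.strictMono_epoch hN).monotone h1).trans hJ)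
  · omega
  · exact le_rfl

/-- The time `t` is treated as one more epoch with the identity as its map, which accounts for the
`+ 1` and turns the final free motion into an ordinary step. `state_eq_config` does the same for
trajectories. -/
lemma corrAt_eq_pairCorr {σ : SyncData N} (hN : 0 < N) (hσ : σ.IsRegular) (η : ℝ) (t : ℝ≥0)
    (M : Fin N → Fin N → ℂ) :
    σ.corrAt η t M = pairCorr η (fun q => (stoppedEpoch t q σ : ℝ)) (fun q => stoppedJump t q σ) M
      (σ.jumpsBefore t + 1) := by
  rw [corrAt_eq hσ, corrAt']
  have h1 : pairCorr η σ.epoch (fun q => jump q σ) M (σ.jumpsBefore t) =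
      pairCorr η (fun q => (stoppedEpoch t q σ : ℝ)) (fun q => stoppedJump t q σ) M
        (σ.jumpsBefore t) :=
    pairCorr_congr η M (fun i hi => by simp [stoppedEpoch, hi, hσ.epoch_nonneg hN])
      (fun i hi => by simp [stoppedJump, hi])
  ext a b
  simp only [pairCorr]
  rw [h1]
  simp [stoppedEpoch, stoppedJump, hσ.epoch_nonneg hN]

end SyncData

namespace Ingredients

variable {Ω : Type*} {N d : ℕ}

/-- The synchronization data of a system. -/
def syncData (S : Ingredients Ω N d) (ω : Ω) : SyncData N :=
  (fun p => S.gap p.1 p.2 ω, fun p => S.dest p.1 p.2 ω)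

lemma epoch_eq (S : Ingredients Ω N d) (ω : Ω) (q : ℕ) :
    S.epoch ω q = (S.syncData ω).epoch q := by
  induction q with
  | zero => rfl
  | succ q ih =>
    simp only [SyncData.epoch, epoch] at ih ⊢
    rw [ih]
    rfl

lemma jumpMap_eq (S : Ingredients Ω N d) (ω : Ω) (s : ℝ) :
    S.jumpMap ω s = (S.syncData ω).jumpMap s := rfl

lemma jumpsBefore_eq (S : Ingredients Ω N d) (ω : Ω) (t : ℝ≥0) :
    S.jumpsBefore ω t = (S.syncData ω).jumpsBefore t := by
  simp only [jumpsBefore, SyncData.jumpsBefore, epoch_eq]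

lemma afterJump_eq (S : Ingredients Ω N d) (ω : Ω) (q : ℕ) :
    S.afterJump ω q = config (S.init ω)
      (fun i j => S.free j ((S.syncData ω).epoch i).toNNReal ω)
      (fun i => (S.syncData ω).jumpMap ((S.syncData ω).epoch (i + 1))) q := by
  induction q with
  | zero => rfl
  | succ q ih =>
    ext1 a
    simp only [afterJump, config, ih, Function.comp, jumpMap_eq, epoch_eq]

lemma state_eq_config (S : Ingredients Ω N d) {ω : Ω}
    (hω : (S.syncData ω).IsRegular) (t : ℝ≥0) (a : Fin N) :
    S.state a t ω = config (S.init ω)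
      (fun i j => S.free j (SyncData.stoppedEpoch t i (S.syncData ω)) ω)
      (fun i => SyncData.stoppedJump t i (S.syncData ω)) ((S.syncData ω).jumpsBefore t + 1) a := by
  rw [state, afterJump_eq, jumpsBefore_eq, epoch_eq]
  simp only [config]
  rw [config_congr (S.init ω) (q := (S.syncData ω).jumpsBefore t)
    (y' := fun i j => S.free j (SyncData.stoppedEpoch t i (S.syncData ω)) ω)
    (f' := fun i => SyncData.stoppedJump t i (S.syncData ω))]
  · simp [SyncData.stoppedJump, SyncData.stoppedEpoch]
  · intro i hi
    simp [SyncData.stoppedEpoch, hi]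
  · intro i hi
    simp [SyncData.stoppedJump, hi, SyncData.jump_eq hω]

/-- The difference of two components, with the free dynamics evaluated on a grid, as a function
of the synchronization data, the initial state, and the free dynamics. -/
noncomputable def gridDiff (t : ℝ≥0) (a b : Fin N) (n : ℕ) (z : SyncData N ×
    ((Fin N → EuclideanSpace ℝ (Fin d)) × (Fin N → ℝ≥0 → EuclideanSpace ℝ (Fin d)))) :
    EuclideanSpace ℝ (Fin d) :=
  config z.2.1 (fun i j => z.2.2 j (roundUp n (SyncData.stoppedEpoch t i z.1)))
      (fun i => SyncData.stoppedJump t i z.1) (z.1.jumpsBefore t + 1) a -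
    config z.2.1 (fun i j => z.2.2 j (roundUp n (SyncData.stoppedEpoch t i z.1)))
      (fun i => SyncData.stoppedJump t i z.1) (z.1.jumpsBefore t + 1) b

/-- For the product σ-algebra on all paths, evaluation at a random time need not be measurable; at
times taking countably many values it is. -/
lemma measurable_gridDiff (t : ℝ≥0) (a b : Fin N) (n : ℕ) :
    Measurable (gridDiff (d := d) t a b n) := by
  have hy : ∀ (i : ℕ) (j : Fin N), Measurable fun z : SyncData N ×
      ((Fin N → EuclideanSpace ℝ (Fin d)) × (Fin N → ℝ≥0 → EuclideanSpace ℝ (Fin d))) =>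
      z.2.2 j (roundUp n (SyncData.stoppedEpoch t i z.1)) := fun i j => by
    have hm : Measurable fun z : SyncData N ×
        ((Fin N → EuclideanSpace ℝ (Fin d)) × (Fin N → ℝ≥0 → EuclideanSpace ℝ (Fin d))) =>
        ⌈SyncData.stoppedEpoch t i z.1 * (n + 1)⌉₊ :=
      Nat.measurable_ceil.comp
        (((SyncData.measurable_stoppedEpoch t i).comp measurable_fst).mul_const _)
    exact measurable_index (F := fun (k : ℕ) (z : SyncData N ×
      ((Fin N → EuclideanSpace ℝ (Fin d)) × (Fin N → ℝ≥0 → EuclideanSpace ℝ (Fin d)))) =>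
      z.2.2 j ((k : ℝ≥0) / (n + 1))) (fun k => by fun_prop) hm
  have hc : ∀ c, Measurable fun z : SyncData N ×
      ((Fin N → EuclideanSpace ℝ (Fin d)) × (Fin N → ℝ≥0 → EuclideanSpace ℝ (Fin d))) =>
      config z.2.1 (fun i j => z.2.2 j (roundUp n (SyncData.stoppedEpoch t i z.1)))
        (fun i => SyncData.stoppedJump t i z.1) (z.1.jumpsBefore t + 1) c := fun c =>
    measurable_index (fun q => measurable_config (measurable_fst.comp measurable_snd) hy
      (fun q => (SyncData.measurable_stoppedJump t q).comp measurable_fst) (q + 1) c)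
      ((SyncData.measurable_jumpsBefore t).comp measurable_fst)
  exact (hc a).sub (hc b)

/-- The initial state and the free dynamics. -/
def motion (S : Ingredients Ω N d) (ω : Ω) :
    (Fin N → EuclideanSpace ℝ (Fin d)) × (Fin N → ℝ≥0 → EuclideanSpace ℝ (Fin d)) :=
  (S.init ω, fun j t => S.free j t ω)

end Ingredients

/-! ### From the synchronization data to the model. -/

section Model

variable {Ω : Type*} [MeasurableSpace Ω] {P : Measure Ω} {N d : ℕ}
  {S : Ingredients Ω N d} {ψ : EuclideanSpace ℝ (Fin d) → ℂ} {F : Fin N → Measure ℝ}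
  {R : Matrix (Fin N) (Fin N) ℝ}

lemma IsGG.measurable_syncData (hS : IsGG P S (fun _ => ψ) F R) : Measurable S.syncData :=
  (measurable_pi_lambda _ fun p : Fin N × ℕ => hS.measurable_gap p.1 p.2).prodMk
    (measurable_pi_lambda _ fun p : Fin N × ℕ => hS.measurable_dest p.1 p.2)

lemma IsGG.measurable_motion (hS : IsGG P S (fun _ => ψ) F R) : Measurable S.motion :=
  hS.measurable_init.prodMk
    (measurable_pi_lambda _ fun j => measurable_pi_lambda _ fun t => (hS.levy_free j).measurable t)

variable [IsProbabilityMeasure P]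

/-- The synchronization data are independent of the initial state and the free dynamics. -/
lemma IsGG.map_syncData_motion (hS : IsGG P S (fun _ => ψ) F R) :
    P.map (fun ω => (S.syncData ω, S.motion ω)) = (P.map S.syncData).prod (P.map S.motion) := by
  set X : Ω → Fin N → ℝ≥0 → EuclideanSpace ℝ (Fin d) := fun ω j t => S.free j t ω with hX
  have hXm : Measurable X := measurable_snd.comp hS.measurable_motion
  have hσm := hS.measurable_syncData
  have hIm := hS.measurable_init
  have hcurry : Measurable fun p : (Fin N → ℕ → ℝ) × (Fin N → ℕ → Fin N) =>
      ((fun q => p.1 q.1 q.2, fun q => p.2 q.1 q.2) : SyncData N) := by fun_prop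
  have h1 : IndepFun S.init (fun ω => (X ω, S.syncData ω)) P :=
    hS.indep_init.comp (ψ := fun p : (Fin N → ℝ≥0 → EuclideanSpace ℝ (Fin d)) ×
      (Fin N → ℕ → ℝ) × (Fin N → ℕ → Fin N) =>
        (p.1, ((fun q => p.2.1 q.1 q.2, fun q => p.2.2 q.1 q.2) : SyncData N)))
      measurable_id (measurable_fst.prodMk (hcurry.comp measurable_snd))
  have h2 : IndepFun X S.syncData P := hS.indep_free_sync.comp measurable_id hcurry
  have h3 : IndepFun S.init X P := h1.comp measurable_id measurable_fst
  have e1 := h1.map_prod_eq_prod_map_map hIm.aemeasurable (hXm.prodMk hσm).aemeasurable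
  rw [h2.map_prod_eq_prod_map_map hXm.aemeasurable hσm.aemeasurable] at e1
  have e2 : P.map S.motion = (P.map S.init).prod (P.map X) :=
    h3.map_prod_eq_prod_map_map hIm.aemeasurable hXm.aemeasurable
  have : IsProbabilityMeasure (P.map S.init) := Measure.isProbabilityMeasure_map hIm.aemeasurable
  have : IsProbabilityMeasure (P.map X) := Measure.isProbabilityMeasure_map hXm.aemeasurable
  have : IsProbabilityMeasure (P.map S.syncData) :=
    Measure.isProbabilityMeasure_map hσm.aemeasurable
  have e3 := (measurePreserving_prodAssoc (P.map S.init) (P.map X) (P.map S.syncData)).symm.map_eq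
  rw [← e1, Measure.map_map (MeasurableEquiv.measurable _) (hIm.prodMk (hXm.prodMk hσm)),
    ← e2] at e3
  rw [← Measure.prod_swap, ← e3, Measure.map_map measurable_swap
    ((MeasurableEquiv.measurable _).comp (hIm.prodMk (hXm.prodMk hσm)))]
  rfl

/-- The law of the synchronization data of the Markovian symmetric model. -/
lemma IsGMS.map_syncData {m : ℝ} (hS : IsGMS P S ψ m) :
    P.map S.syncData = SyncData.law (1 / m) fun k => P.map (S.dest k 0) := by
  have hG := hS.toIsGG
  have hgm : Measurable fun ω => (fun p : Fin N × ℕ => S.gap p.1 p.2 ω) :=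
    measurable_fst.comp hG.measurable_syncData
  have hdm : Measurable fun ω => (fun p : Fin N × ℕ => S.dest p.1 p.2 ω) :=
    measurable_snd.comp hG.measurable_syncData
  have hind : IndepFun (fun ω => (fun p : Fin N × ℕ => S.gap p.1 p.2 ω))
      (fun ω => (fun p : Fin N × ℕ => S.dest p.1 p.2 ω)) P :=
    hG.indep_gap_dest.comp (φ := fun x : Fin N → ℕ → ℝ => fun p : Fin N × ℕ => x p.1 p.2)
      (ψ := fun x : Fin N → ℕ → Fin N => fun p : Fin N × ℕ => x p.1 p.2)
      (by fun_prop) (by fun_prop)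
  have hdest : ∀ k n, P.map (S.dest k n) = P.map (S.dest k 0) := fun k n => by
    refine Measure.ext_of_singleton fun j => ?_
    have h : ∀ n, P.map (S.dest k n) {j} = ENNReal.ofReal (uniformRouting N k j) := fun n => by
      rw [Measure.map_apply (hG.measurable_dest k n) (measurableSet_singleton j),
        ← hG.law_dest k n j, ofReal_measureReal]
      rfl
    rw [h, h]
  have e1 := hind.map_prod_eq_prod_map_map hgm.aemeasurable hdm.aemeasurable
  have e2 := hG.indep_gap.map_fun_eq_infinitePi_map fun p : Fin N × ℕ => hG.measurable_gap p.1 p.2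
  have e3 := hG.indep_dest.map_fun_eq_infinitePi_map fun p : Fin N × ℕ => hG.measurable_dest p.1 p.2
  rw [e2, e3] at e1
  simp_rw [hdest, (hG.law_gap _ _).map_eq] at e1
  exact e1

end Model

section Model

variable {Ω : Type*} [MeasurableSpace Ω] {P : Measure Ω} {N d : ℕ}
  {S : Ingredients Ω N d} {ψ : EuclideanSpace ℝ (Fin d) → ℂ} {m : ℝ}

lemma IsGMS.measurable_gridDiff (hS : IsGMS P S ψ m) (t : ℝ≥0) (a b : Fin N) (n : ℕ) :
    Measurable fun ω => Ingredients.gridDiff t a b n (S.syncData ω, S.motion ω) :=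
  (Ingredients.measurable_gridDiff t a b n).comp
    (hS.toIsGG.measurable_syncData.prodMk hS.toIsGG.measurable_motion)

variable [IsProbabilityMeasure P]

lemma IsGMS.isProbabilityMeasure_dest (hS : IsGMS P S ψ m) (k : Fin N) :
    IsProbabilityMeasure (P.map (S.dest k 0)) :=
  Measure.isProbabilityMeasure_map (hS.measurable_dest k 0).aemeasurable

lemma IsGMS.ae_isRegular (hS : IsGMS P S ψ m) (hm : 0 < m) :
    ∀ᵐ ω ∂P, (S.syncData ω).IsRegular := by
  have := hS.isProbabilityMeasure_dest
  have h := SyncData.ae_isRegular (r := 1 / m) (fun k => P.map (S.dest k 0)) (by positivity)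
  rw [← hS.map_syncData] at h
  exact ae_of_ae_map hS.toIsGG.measurable_syncData.aemeasurable h

/-- For fixed data the maps and the number of jumps do not depend on the grid; only finitely many
evaluation times move, and they decrease to or stay at their limits from the right in the sense of
`tendsto_roundUp`. -/
lemma IsGMS.ae_tendsto_gridDiff (hS : IsGMS P S ψ m) (hm : 0 < m) (t : ℝ≥0) (a b : Fin N) :
    ∀ᵐ ω ∂P, Tendsto (fun n => Ingredients.gridDiff t a b n (S.syncData ω, S.motion ω)) atTop
      (𝓝 (S.diff a b t ω)) := by
  have hrc : ∀ᵐ ω ∂P, ∀ j t, ContinuousWithinAt (fun s => S.free j s ω) (Set.Ici t) t :=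
    ae_all_iff.2 fun j => (hS.levy_free j).right_continuous
  filter_upwards [hS.ae_isRegular hm, hrc] with ω hω hc
  have h := fun c => tendsto_config (S.init ω)
    (fun i => SyncData.stoppedJump t i (S.syncData ω))
    (fun i j => (hc j (SyncData.stoppedEpoch t i (S.syncData ω))).tendsto.comp
      (tendsto_roundUp _)) ((S.syncData ω).jumpsBefore t + 1) c
  rw [Ingredients.diff, S.state_eq_config hω, S.state_eq_config hω]
  exact (h a).sub (h b)

lemma IsGMS.aemeasurable_diff (hS : IsGMS P S ψ m) (hm : 0 < m) (t : ℝ≥0) (a b : Fin N) :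
    AEMeasurable (S.diff a b t) P :=
  aemeasurable_of_tendsto_metrizable_ae atTop
    (fun n => (hS.measurable_gridDiff t a b n).aemeasurable) (hS.ae_tendsto_gridDiff hm t a b)

lemma norm_initCorr_le (u : EuclideanSpace ℝ (Fin d)) (a b : Fin N) :
    ‖initCorr P S u a b‖ ≤ 1 := by
  have h := norm_integral_le_of_norm_le_const (μ := P) (C := 1)
    (f := fun ω => Complex.exp (Complex.I * (inner ℝ u (S.init ω a - S.init ω b) : ℝ)))
    (ae_of_all _ fun ω => by rw [mul_comm, Complex.norm_exp_ofReal_mul_I])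
  simpa [initCorr] using h

/-- Averaging over the initial state and the free dynamics, given the synchronization data. -/
lemma IsGMS.integral_gridDiff (hS : IsGMS P S ψ m) (hm : 0 < m) (t : ℝ≥0) (a b : Fin N)
    (u : EuclideanSpace ℝ (Fin d)) (n : ℕ) :
    ∫ ω, Complex.exp (Complex.I *
      ((inner ℝ u (Ingredients.gridDiff t a b n (S.syncData ω, S.motion ω)) : ℝ) : ℂ)) ∂P =
    ∫ ω, pairCorr (eta ψ u)
      (fun q => (roundUp n (SyncData.stoppedEpoch t q (S.syncData ω)) : ℝ))
      (fun q => SyncData.stoppedJump t q (S.syncData ω)) (initCorr P S u)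
      ((S.syncData ω).jumpsBefore t + 1) a b ∂P := by
  have hG := hS.toIsGG
  have hσm := hG.measurable_syncData
  have hzm := hG.measurable_motion
  have : IsProbabilityMeasure (P.map S.syncData) :=
    Measure.isProbabilityMeasure_map hσm.aemeasurable
  have : IsProbabilityMeasure (P.map S.motion) :=
    Measure.isProbabilityMeasure_map hzm.aemeasurable
  set φ : SyncData N ×
      ((Fin N → EuclideanSpace ℝ (Fin d)) × (Fin N → ℝ≥0 → EuclideanSpace ℝ (Fin d))) → ℂ :=
    fun z => Complex.exp (Complex.I * ((inner ℝ u (Ingredients.gridDiff t a b n z) : ℝ) : ℂ))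
    with hφ
  have hφm : Measurable φ := by
    have := Ingredients.measurable_gridDiff (d := d) t a b n
    simp only [hφ]
    fun_prop
  have hφi : Integrable φ ((P.map S.syncData).prod (P.map S.motion)) :=
    Integrable.of_bound hφm.aestronglyMeasurable 1
      (ae_of_all _ fun z => by simp only [hφ]; rw [mul_comm, Complex.norm_exp_ofReal_mul_I])
  have h1 : ∫ ω, φ (S.syncData ω, S.motion ω) ∂P =
      ∫ σ, ∫ z, φ (σ, z) ∂P.map S.motion ∂P.map S.syncData := by
    -- Independence of data and motion makes the joint law a product, so Fubini freezes the data.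
    -- The rounded times then become deterministic and monotone, as required by
    -- `integral_exp_config`.
    rw [← integral_prod _ hφi, ← hG.map_syncData_motion,
      integral_map (hσm.prodMk hzm).aemeasurable hφm.aestronglyMeasurable]
  refine h1.trans ?_
  rw [integral_map hσm.aemeasurable hφm.stronglyMeasurable.integral_prod_right.aestronglyMeasurable]
  refine integral_congr_ae ?_
  filter_upwards [hS.ae_isRegular hm] with ω hω
  have hN : 0 < N := a.pos
  have hφm' : Measurable fun z => φ (S.syncData ω, z) := hφm.comp measurable_prodMk_left
  rw [integral_map hzm.aemeasurable hφm'.aestronglyMeasurable]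
  have h2 := integral_exp_config hG
    (τ := fun q => roundUp n (SyncData.stoppedEpoch t q (S.syncData ω)))
    ((roundUp_mono n).comp (hω.monotone_stoppedEpoch hN t))
    (fun q => SyncData.stoppedJump t q (S.syncData ω)) u ((S.syncData ω).jumpsBefore t + 1) a b
  simp only [hφ, Ingredients.gridDiff, Ingredients.motion]
  exact h2

/-- The characteristic function of a difference is the mean of the pair correlations. -/
lemma IsGMS.chi_eq_meanCorr (hS : IsGMS P S ψ m) (hm : 0 < m) (t : ℝ≥0) (a b : Fin N)
    (u : EuclideanSpace ℝ (Fin d)) :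
    S.chi P a b t u = SyncData.meanCorr (1 / m) (fun k => P.map (S.dest k 0)) (eta ψ u) t
      (initCorr P S u) a b := by
  have hN : 0 < N := a.pos
  have hG := hS.toIsGG
  have hσm := hG.measurable_syncData
  have := hS.isProbabilityMeasure_dest
  have hη := (hS.levy_free a).eta_nonneg u
  have hreg := hS.ae_isRegular hm
  have hrhs : SyncData.meanCorr (1 / m) (fun k => P.map (S.dest k 0)) (eta ψ u) t
      (initCorr P S u) a b = ∫ ω, (S.syncData ω).corrAt (eta ψ u) t (initCorr P S u) a b ∂P := by
    have hmeas := SyncData.aestronglyMeasurable_corrAt (r := 1 / m) (by positivity)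
      (fun k => P.map (S.dest k 0)) (eta ψ u) t (initCorr P S u) a b
    rw [← hS.map_syncData] at hmeas
    rw [SyncData.meanCorr, ← hS.map_syncData, integral_map hσm.aemeasurable hmeas]
  rw [hrhs]
  -- Both sides of `integral_gridDiff` are passed to the limit of a fine grid by dominated
  -- convergence, all integrands being bounded by `1`.
  have hleft : Tendsto (fun n => ∫ ω, Complex.exp (Complex.I * ((inner ℝ u
      (Ingredients.gridDiff t a b n (S.syncData ω, S.motion ω)) : ℝ) : ℂ)) ∂P) atTop
      (𝓝 (S.chi P a b t u)) := by
    refine tendsto_integral_of_dominated_convergence (fun _ => 1) (fun n => ?_)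
      (integrable_const _) (fun n => ae_of_all _ fun ω => ?_) ?_
    · have := hS.measurable_gridDiff t a b n
      exact Measurable.aestronglyMeasurable (by fun_prop)
    · rw [mul_comm, Complex.norm_exp_ofReal_mul_I]
    · filter_upwards [hS.ae_tendsto_gridDiff hm t a b] with ω hω
      have hc : Continuous fun x : EuclideanSpace ℝ (Fin d) =>
          Complex.exp (Complex.I * ((inner ℝ u x : ℝ) : ℂ)) := by fun_prop
      exact (hc.tendsto _).comp hω
  have hright : Tendsto (fun n => ∫ ω, pairCorr (eta ψ u)
      (fun q => (roundUp n (SyncData.stoppedEpoch t q (S.syncData ω)) : ℝ))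
      (fun q => SyncData.stoppedJump t q (S.syncData ω)) (initCorr P S u)
      ((S.syncData ω).jumpsBefore t + 1) a b ∂P) atTop
      (𝓝 (∫ ω, (S.syncData ω).corrAt (eta ψ u) t (initCorr P S u) a b ∂P)) := by
    refine tendsto_integral_of_dominated_convergence (fun _ => 1) (fun n => ?_)
      (integrable_const _) (fun n => ?_) ?_
    · have hτ : ∀ q, Measurable fun σ : SyncData N =>
          (roundUp n (SyncData.stoppedEpoch t q σ) : ℝ) := fun q =>
        ((roundUp_mono n).measurable.comp (SyncData.measurable_stoppedEpoch t q)).coe_nnreal_real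
      have h : Measurable fun σ : SyncData N => pairCorr (eta ψ u)
          (fun q => (roundUp n (SyncData.stoppedEpoch t q σ) : ℝ))
          (fun q => SyncData.stoppedJump t q σ) (initCorr P S u) (σ.jumpsBefore t + 1) a b :=
        measurable_index (fun q => measurable_pairCorr (eta ψ u) hτ
          (SyncData.measurable_stoppedJump t) (initCorr P S u) (q + 1) a b)
          (SyncData.measurable_jumpsBefore t)
      exact (h.comp hσm).aestronglyMeasurable
    · filter_upwards [hreg] with ω hω
      refine norm_pairCorr_le hη (fun p q hpq => ?_) _ (norm_initCorr_le u) _ _ _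
      exact_mod_cast roundUp_mono n (hω.monotone_stoppedEpoch hN t hpq)
    · filter_upwards [hreg] with ω hω
      rw [SyncData.corrAt_eq_pairCorr hN hω]
      refine tendsto_pairCorr _ _ _ (fun q => ?_) _ _ _
      exact (NNReal.tendsto_coe.2
        ((tendsto_roundUp (SyncData.stoppedEpoch t q (S.syncData ω))).mono_right nhdsWithin_le_nhds))
  simp_rw [hS.integral_gridDiff hm] at hleft
  exact tendsto_nhds_unique hleft hright

/-- The correlations of an exchangeable initial configuration. -/
lemma IsGMS.exists_initCorr_eq (hS : IsGMS P S ψ m) (u : EuclideanSpace ℝ (Fin d)) :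
    ∃ c : ℂ, ‖c‖ ≤ 1 ∧ initCorr P S u = constCorr N c := by
  have hIm := hS.toIsGG.measurable_init
  have hinv : ∀ (π : Equiv.Perm (Fin N)) a b,
      initCorr P S u (π a) (π b) = initCorr P S u a b := fun π a b => by
    have hf : Measurable fun x : Fin N → EuclideanSpace ℝ (Fin d) =>
        Complex.exp (Complex.I * ((inner ℝ u (x a - x b) : ℝ) : ℂ)) := by fun_prop
    have hπ : Measurable fun ω => S.init ω ∘ π :=
      measurable_pi_lambda _ fun i => (measurable_pi_apply (π i)).comp hIm
    have h1 := integral_map (μ := P) hπ.aemeasurable hf.aestronglyMeasurable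
    have h2 := integral_map (μ := P) hIm.aemeasurable hf.aestronglyMeasurable
    rw [hS.exchangeable_init π, h2] at h1
    exact h1.symm
  by_cases h : ∃ a b : Fin N, a ≠ b
  · obtain ⟨a, b, hab⟩ := h
    refine ⟨initCorr P S u a b, norm_initCorr_le u a b, ?_⟩
    ext a' b'
    unfold constCorr
    split_ifs with h
    · subst h
      simp [initCorr]
    -- The permutation first swaps `a` with `a'`, then moves the image of `b` to `b'`. The
    -- inequality ensures that the second swap leaves `a'` in place, so the pair `(a, b)` is carried
    -- to `(a', b')`.
    · have hb : Equiv.swap a a' b ≠ a' := fun h' => hab (by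
        rw [Equiv.swap_apply_eq_iff, Equiv.swap_apply_right] at h'
        exact h'.symm)
      have e1 : (Equiv.swap (Equiv.swap a a' b) b' * Equiv.swap a a') a = a' := by
        simp only [Equiv.Perm.mul_apply, Equiv.swap_apply_left]
        exact Equiv.swap_apply_of_ne_of_ne hb.symm h
      have e2 : (Equiv.swap (Equiv.swap a a' b) b' * Equiv.swap a a') b = b' := by
        simp only [Equiv.Perm.mul_apply, Equiv.swap_apply_left]
      rw [← hinv (Equiv.swap (Equiv.swap a a' b) b' * Equiv.swap a a') a b, e1, e2]
  · push Not at h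
    refine ⟨0, by simp, ?_⟩
    ext a b
    have := h a b
    subst this
    simp [constCorr, initCorr]

/-- The characteristic function of a difference solves the relaxation equation. -/
theorem IsGMS.exists_chi_eq_relax (hS : IsGMS P S ψ m) (hm : 0 < m) (hN : 2 ≤ N)
    (u : EuclideanSpace ℝ (Fin d)) :
    ∃ c : ℂ, ∀ a b : Fin N, a ≠ b → ∀ t : ℝ≥0,
      S.chi P a b t u = relax (eta ψ u) (wN N m) t c := by
  obtain ⟨c, hc, hI⟩ := hS.exists_initCorr_eq u
  refine ⟨c, fun a b hab t => ?_⟩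
  have := hS.isProbabilityMeasure_dest
  have hν : ∀ k j, (P.map (S.dest k 0)).real {j} = uniformRouting N k j := fun k j => by
    rw [map_measureReal_apply (hS.measurable_dest k 0) (measurableSet_singleton j)]
    exact hS.law_dest k 0 j
  have hr : 0 < 1 / m := by positivity
  rw [hS.chi_eq_meanCorr hm, hI, SyncData.meanCorr_eq_relax (fun k => P.map (S.dest k 0)) hr hN hν
    ((hS.levy_free a).eta_nonneg u) t.coe_nonneg hc hab]
  congr 1
  rw [wN]
  have h2 : (2 : ℝ) ≤ N := by exact_mod_cast hN
  have : (N : ℝ) - 1 ≠ 0 := by linarith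
  field_simp

end Model

/-! ### Relaxation to equilibrium and Lévy continuity. -/

lemma hasDerivAt_relax {η w : ℝ} (hq : η + w ≠ 0) (t : ℝ) (c : ℂ) :
    HasDerivAt (fun s => relax η w s c) (-((η + w : ℝ) : ℂ) * relax η w t c + w) t := by
  have h := ((hasDerivAt_ofReal_exp (η + w) t).const_mul
    (c - ((w / (η + w) : ℝ) : ℂ))).const_add ((w / (η + w) : ℝ) : ℂ)
  have hl : ((η + w : ℝ) : ℂ) * ((w / (η + w) : ℝ) : ℂ) = w := by
    rw [← Complex.ofReal_mul, mul_div_cancel₀ _ hq]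
  convert! h using 1
  simp only [relax]
  linear_combination -hl

lemma tendsto_relax {η w : ℝ} (hq : 0 < η + w) (c : ℂ) :
    Tendsto (fun t : ℝ≥0 => relax η w t c) atTop (𝓝 ((w / (η + w) : ℝ) : ℂ)) := by
  have h1 : Tendsto (fun t : ℝ≥0 => Real.exp (-((η + w) * t))) atTop (𝓝 0) :=
    Real.tendsto_exp_neg_atTop_nhds_zero.comp
      ((NNReal.tendsto_coe_atTop.2 tendsto_id).const_mul_atTop hq)
  have h2 : Tendsto (fun t : ℝ≥0 => ((Real.exp (-((η + w) * t)) : ℝ) : ℂ)) atTop (𝓝 0) := by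
    have h := (Complex.continuous_ofReal.tendsto 0).comp h1
    rwa [Complex.ofReal_zero] at h
  simpa [relax] using (h2.const_mul (c - ((w / (η + w) : ℝ) : ℂ))).const_add ((w / (η + w) : ℝ) : ℂ)

/-- **Lévy's continuity theorem**: a pointwise limit of characteristic functions that is continuous
at the origin is a characteristic function. -/
lemma exists_charFun_eq_of_tendsto {E : Type*} [NormedAddCommGroup E] [InnerProductSpace ℝ E]
    [FiniteDimensional ℝ E] [MeasurableSpace E] [BorelSpace E] {μ : ℕ → ProbabilityMeasure E}
    {f : E → ℂ} (hf : ContinuousAt f 0)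
    (h : ∀ u, Tendsto (fun n => charFun (μ n : Measure E) u) atTop (𝓝 (f u))) :
    ∃ Q : ProbabilityMeasure E, ∀ u, charFun (Q : Measure E) u = f u := by
  have ht := isTightMeasureSet_of_tendsto_charFun hf h
  have hc : IsCompact (closure (Set.range μ)) := isCompact_closure_of_isTightMeasureSet
    (by convert! ht using 1; ext ν; simp)
  -- Tightness gives relative compactness, so the sequence converges along an ultrafilter; the limit
  -- of characteristic functions along it is still `f`, and no subsequence has to be extracted.
  obtain ⟨Q, -, hQ⟩ := hc.ultrafilter_le_nhds ((hyperfilter ℕ).map μ)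
    (by
      rw [Ultrafilter.coe_map, le_principal_iff, mem_map]
      exact univ_mem' fun n => subset_closure (Set.mem_range_self n))
  refine ⟨Q, fun u => ?_⟩
  have hQ' : Tendsto μ (hyperfilter ℕ : Filter ℕ) (𝓝 Q) := hQ
  rw [ProbabilityMeasure.tendsto_iff_forall_integral_rclike_tendsto ℂ] at hQ'
  have h1 := hQ' (BoundedContinuousFunction.innerProbChar u)
  simp_rw [← charFun_eq_integral_innerProbChar] at h1
  exact tendsto_nhds_unique h1 ((h u).mono_left Nat.hyperfilter_le_atTop)

section Model

variable {Ω : Type*} [MeasurableSpace Ω] {P : Measure Ω} [IsProbabilityMeasure P] {N d : ℕ}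
  {S : Ingredients Ω N d} {ψ : EuclideanSpace ℝ (Fin d) → ℂ} {m : ℝ}

/-- `η` is `-2 log` of the modulus of the characteristic function at time `1`, which is continuous
and nowhere zero. This yields the continuity at the origin required by Lévy's theorem. -/
lemma IsLevyWithExponent.continuous_eta {X : ℝ≥0 → Ω → EuclideanSpace ℝ (Fin d)}
    (h : IsLevyWithExponent P X ψ) : Continuous (eta ψ) := by
  have : IsProbabilityMeasure (P.map (X 1)) :=
    Measure.isProbabilityMeasure_map (h.measurable 1).aemeasurable
  have h1 : ∀ u, ‖charFun (P.map (X 1)) u‖ = Real.exp (ψ u).re := fun u => by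
    rw [h.charFun_eq, Complex.norm_exp]
    simp
  have h2 : eta ψ = fun u => -2 * Real.log ‖charFun (P.map (X 1)) u‖ := by
    ext u
    rw [h1, Real.log_exp, eta]
  rw [h2]
  have hc : Continuous (charFun (P.map (X 1))) := by fun_prop
  exact continuous_const.mul (hc.norm.log fun u => by rw [h1]; exact (Real.exp_pos _).ne')

lemma IsGMS.charFun_map_diff (hS : IsGMS P S ψ m) (hm : 0 < m) (t : ℝ≥0) (a b : Fin N)
    (u : EuclideanSpace ℝ (Fin d)) : charFun (P.map (S.diff a b t)) u = S.chi P a b t u := by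
  rw [charFun_apply, integral_map (hS.aemeasurable_diff hm t a b) (by fun_prop)]
  refine integral_congr_ae (ae_of_all _ fun ω => ?_)
  simp only
  rw [real_inner_comm, mul_comm]

end Model

end SyncModel

/-! ### Assembly of the theorem. -/

theorem mainTheorem4 {Ω : Type*} [MeasurableSpace Ω] (P : Measure Ω) [IsProbabilityMeasure P]
    (N d : ℕ) (hN : 2 ≤ N) (m : ℝ) (hm : 0 < m)
    (ψ : EuclideanSpace ℝ (Fin d) → ℂ) (S : SyncModel.Ingredients Ω N d)
    (hS : SyncModel.IsGMS P S ψ m) :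
    -- the characteristic function of `x_j(t) - x_k(t)` is the same for all pairs `j ≠ k`
    (∀ j k j' k' : Fin N, j ≠ k → j' ≠ k' →
      ∀ (t : ℝ≥0) (u : EuclideanSpace ℝ (Fin d)), S.chi P j k t u = S.chi P j' k' t u) ∧
    -- it solves the linear differential equation (with a right derivative at `t = 0`)
    (∀ j k : Fin N, j ≠ k → ∀ (u : EuclideanSpace ℝ (Fin d)) (t : ℝ), 0 ≤ t →
      HasDerivWithinAt (fun s : ℝ => S.chi P j k s.toNNReal u)
        (-(SyncModel.qN N m ψ u : ℂ) * S.chi P j k t.toNNReal u + (SyncModel.wN N m : ℂ))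
        (Set.Ici 0) t) ∧
    -- it converges as `t → ∞` to the explicit limit
    (∀ j k : Fin N, j ≠ k → ∀ u : EuclideanSpace ℝ (Fin d),
      Tendsto (fun t : ℝ≥0 => S.chi P j k t u) atTop
        (𝓝 ((1 / (1 + 1 / 2 * ((N : ℝ) - 1) * m * SyncModel.eta ψ u) : ℝ) : ℂ))) ∧
    -- the limit is the characteristic function of the weak limit of the law of `x_j(t) - x_k(t)`
    ∃ Q : ProbabilityMeasure (EuclideanSpace ℝ (Fin d)),
      (∀ j k : Fin N, j ≠ k →
        TendstoInDistribution (fun t : ℝ≥0 => S.diff j k t) atTop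
          (id : EuclideanSpace ℝ (Fin d) → EuclideanSpace ℝ (Fin d))
          (fun _ => P) (Q : Measure (EuclideanSpace ℝ (Fin d)))) ∧
      ∀ u : EuclideanSpace ℝ (Fin d),
        charFun (Q : Measure (EuclideanSpace ℝ (Fin d))) u =
          ((1 / (1 + 1 / 2 * ((N : ℝ) - 1) * m * SyncModel.eta ψ u) : ℝ) : ℂ) := by
  have h2 : (2 : ℝ) ≤ N := by exact_mod_cast hN
  have hN1 : (0 : ℝ) < N - 1 := by linarith
  have hw : 0 < SyncModel.wN N m := by unfold SyncModel.wN; positivity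
  have hη : ∀ u, 0 ≤ SyncModel.eta ψ u := (hS.levy_free ⟨0, by omega⟩).eta_nonneg
  choose c hc using SyncModel.IsGMS.exists_chi_eq_relax hS hm hN
  have hlim : ∀ j k : Fin N, j ≠ k → ∀ u : EuclideanSpace ℝ (Fin d),
      Tendsto (fun t : ℝ≥0 => S.chi P j k t u) atTop
        (𝓝 ((1 / (1 + 1 / 2 * ((N : ℝ) - 1) * m * SyncModel.eta ψ u) : ℝ) : ℂ)) := by
    intro j k hjk u
    have hη' := hη u
    have h := SyncModel.tendsto_relax (η := SyncModel.eta ψ u) (add_pos_of_nonneg_of_pos hη' hw)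
      (c u)
    have he : SyncModel.wN N m / (SyncModel.eta ψ u + SyncModel.wN N m) =
        1 / (1 + 1 / 2 * ((N : ℝ) - 1) * m * SyncModel.eta ψ u) := by
      have h3 : 0 ≤ ((N : ℝ) - 1) * m * SyncModel.eta ψ u := by positivity
      have h4 : 1 + 1 / 2 * ((N : ℝ) - 1) * m * SyncModel.eta ψ u ≠ 0 := by linarith
      have h5 : SyncModel.eta ψ u + SyncModel.wN N m ≠ 0 :=
        (add_pos_of_nonneg_of_pos hη' hw).ne'
      rw [div_eq_div_iff h5 h4]
      unfold SyncModel.wN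
      field_simp
      ring
    rw [he] at h
    simpa only [hc u j k hjk] using h
  refine ⟨fun j k j' k' hjk hjk' t u => by rw [hc u j k hjk, hc u j' k' hjk'], ?_, hlim, ?_⟩
  · intro j k hjk u t ht
    have h := (SyncModel.hasDerivAt_relax (add_pos_of_nonneg_of_pos (hη u) hw).ne' t
      (c u)).hasDerivWithinAt (s := Set.Ici 0)
    -- `toNNReal` is the identity only on `[0, ∞)`, so the formula, and with it the derivative,
    -- holds within that set.
    have he : ∀ s ∈ Set.Ici (0 : ℝ), S.chi P j k s.toNNReal u =
        SyncModel.relax (SyncModel.eta ψ u) (SyncModel.wN N m) s (c u) := fun s hs => by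
      rw [hc u j k hjk, Real.coe_toNNReal s hs]
    rw [he t ht]
    exact h.congr he (he t ht)
  · set a : Fin N := ⟨0, by omega⟩
    set b : Fin N := ⟨1, by omega⟩
    have hab : a ≠ b := by simp [a, b]
    have hmeas := fun t j k => SyncModel.IsGMS.aemeasurable_diff hS hm t j k
    have hf : Continuous fun u : EuclideanSpace ℝ (Fin d) =>
        ((1 / (1 + 1 / 2 * ((N : ℝ) - 1) * m * SyncModel.eta ψ u) : ℝ) : ℂ) := by
      have := (hS.levy_free a).continuous_eta
      refine Complex.continuous_ofReal.comp (continuous_const.div (by fun_prop) fun u => ?_)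
      have hη' := hη u
      have h3 : 0 ≤ ((N : ℝ) - 1) * m * SyncModel.eta ψ u := by positivity
      linarith
    -- One pair of components observed at integer times suffices to construct the limit law; its
    -- characteristic function then governs every pair.
    obtain ⟨Q, hQ⟩ := SyncModel.exists_charFun_eq_of_tendsto
      (μ := fun n : ℕ => ⟨P.map (S.diff a b n), Measure.isProbabilityMeasure_map (hmeas n a b)⟩)
      hf.continuousAt (fun u => by
        simp only [ProbabilityMeasure.coe_mk, SyncModel.IsGMS.charFun_map_diff hS hm]
        exact (hlim a b hab u).comp tendsto_natCast_atTop_atTop)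
    refine ⟨Q, fun j k hjk => ⟨fun t => hmeas t j k, by fun_prop, ?_⟩, hQ⟩
    -- The filter `atTop` on `ℝ≥0` is countably generated, so convergence may be tested along
    -- sequences of times, where pointwise convergence of characteristic functions implies weak
    -- convergence.
    refine tendsto_of_seq_tendsto fun t ht => ?_
    refine ProbabilityMeasure.tendsto_of_tendsto_charFun fun u => ?_
    simp only [ProbabilityMeasure.coe_mk, Measure.map_id, hQ]
    exact ((hlim j k hjk u).comp ht).congr fun n =>
      (SyncModel.IsGMS.charFun_map_diff hS hm (t n) j k u).symm
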